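/- Let $n\ge 2$ and let $A(z,\bar z)\in\mathbb C[z_1,\dots,z_n,\bar z_1,\dots,\bar z_n]$ be a real-valued Hermitian polynomial (not necessarily bihomogeneous). Write $A(z,\bar z)=\sum_{\alpha,\beta}H_{\alpha\beta}\,z^\alpha\bar z^\beta$; the matrix of $A$ is $H=(H_{\alpha\beta})$, where $\alpha,\beta$ run over the multi-indices of degree at most $d$ with $d$ at least the degree of $A$ in $z$ and in $\bar z$. We call $A$ diagonal if $H$ is diagonal, and the rank of a Hermitian polynomial is the rank of its matrix. We call $A$ an SOS if $A(z,\bar z)=\sum_{i=1}^m|h_i(z)|^2$ for finitely many holomorphic polynomials $h_1,\dots,h_m$. Put $\|z\|^2=\sum_{i=1}^n z_i\bar z_i$. Suppose that $A$ is diagonal. (1) If $A$ is not an SOS but $A(z,\bar z)\|z\|^2$ is an SOS, then the rank $R$ of $A(z,\bar z)\|z\|^2$ satisfies $R\ge 3n-4$. (2) If $2\le n\le 6$, then Ebenfelt's SOS conjecture holds for $A$: if $A(z,\bar z)\|z\|^2$ is an SOS (whether or not $A$ itself is one), and $\kappa_0$ denotes the largest integer $\kappa$ with $\kappa(\kappa+1)/2<n$,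 then the rank $R$ of $A(z,\bar z)\|z\|^2$ satisfies either $$R\ \ge\ (\kappa_0+1)n-\frac{(\kappa_0+1)\kappa_0}{2}-1,$$ or, for some $\kappa\in\{0,1,\dots,\kappa_0\}$, $$\kappa n-\frac{\kappa(\kappa-1)}{2}\ \le\ R\ \le\ \kappa n .$$ -/

import Mathlib

noncomputable section

namespace SOSConjecture

/-- Polynomials in `ℂ[z₁, …, zₙ, z̄₁, …, z̄ₙ]`: the variable `Sum.inl i` stands for `zᵢ` and
the variable `Sum.inr i` stands for `z̄ᵢ`. -/
abbrev HermPoly (n : ℕ) : Type := MvPolynomial (Fin n ⊕ Fin n) ℂ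

/-- The value `A(z, z̄)` at a point `z ∈ ℂⁿ`. -/
def value {n : ℕ} (A : HermPoly n) (z : Fin n → ℂ) : ℂ :=
  MvPolynomial.eval (Sum.elim z (fun i => (starRingEnd ℂ) (z i))) A

/-- `A(z, z̄)` is real valued (equivalently, `A` is a Hermitian polynomial). -/
def IsRealValued {n : ℕ} (A : HermPoly n) : Prop :=
  ∀ z : Fin n → ℂ, (value A z).im = 0

/-- The polynomial `‖z‖² = z₁ z̄₁ + ⋯ + zₙ z̄ₙ`. -/
def normSq (n : ℕ) : HermPoly n :=
  ∑ i : Fin n, MvPolynomial.X (Sum.inl i) * MvPolynomial.X (Sum.inr i)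

/-- Exponents of the monomials in `z` of degree at most `d`. -/
abbrev Expo (n d : ℕ) : Type := {α : Fin n →₀ ℕ // α.degree ≤ d}

instance (n d : ℕ) : Finite (Expo n d) := (Finsupp.finite_of_degree_le d).to_subtype

instance (n d : ℕ) : Fintype (Expo n d) := Fintype.ofFinite _

/-- The coefficient matrix of `A` in the monomials of degree at most `d`: its `(α, β)` entry is the
coefficient of `z^α z̄^β`. -/
def coeffMatrix {n : ℕ} (A : HermPoly n) (d : ℕ) : Matrix (Expo n d) (Expo n d) ℂ :=
  Matrix.of fun α β => A.coeff (Finsupp.sumElim α.1 β.1)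

/-- The matrix `H` with `A(z, z̄) = 𝔷 H 𝔷*`, where `𝔷` is the row of all monomials in `z` of degree
at most the total degree of `A`. A larger bound on the degree only adds zero rows and columns. -/
def matrixOf {n : ℕ} (A : HermPoly n) : Matrix (Expo n A.totalDegree) (Expo n A.totalDegree) ℂ :=
  coeffMatrix A A.totalDegree

/-- `A` is diagonal: its matrix is diagonal. -/
def IsDiagonal {n : ℕ} (A : HermPoly n) : Prop := (matrixOf A).IsDiag

/-- The rank of `A`: the rank of its matrix. -/
def rank {n : ℕ} (A : HermPoly n) : ℕ := (matrixOf A).rank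

/-- `A` is a sum of squares (SOS): `A(z, z̄) = ‖h(z)‖²` for some holomorphic polynomial mapping
`h = (h₁, …, h_R)`. -/
def IsSOS {n : ℕ} (A : HermPoly n) : Prop :=
  ∃ (R : ℕ) (h : Fin R → MvPolynomial (Fin n) ℂ), ∀ z : Fin n → ℂ,
    value A z = ((∑ i, ‖MvPolynomial.eval z (h i)‖ ^ 2 : ℝ) : ℂ)

/-- The alternative for the rank `R` in Ebenfelt's SOS conjecture in dimension `n`, where `κ₀` is
the largest integer with `κ₀(κ₀+1)/2 < n`: either `R ≥ (κ₀+1)n - (κ₀+1)κ₀/2 - 1`, or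
`κ n - κ(κ-1)/2 ≤ R ≤ κ n` for some `κ ∈ {0, …, κ₀}`. -/
def RankAlternative (n R : ℕ) : Prop :=
  ∃ κ₀ : ℕ, IsGreatest {κ : ℕ | (κ : ℚ) * (κ + 1) / 2 < n} κ₀ ∧
    (((κ₀ : ℚ) + 1) * n - ((κ₀ : ℚ) + 1) * κ₀ / 2 - 1 ≤ R ∨
      ∃ κ : ℕ, κ ≤ κ₀ ∧ (κ : ℚ) * n - (κ : ℚ) * (κ - 1) / 2 ≤ R ∧ (R : ℚ) ≤ κ * n)

/-- Ebenfelt's SOS conjecture for the polynomial `A`: if `A(z, z̄)‖z‖²` is an SOS, then its rank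
satisfies the alternative above. -/
def EbenfeltConjectureFor {n : ℕ} (A : HermPoly n) : Prop :=
  IsSOS (A * normSq n) → RankAlternative n (rank (A * normSq n))

end SOSConjecture

end

noncomputable section

open MvPolynomial

namespace DiagonalSOS

/-! ### Coefficients of the product of a polynomial with a sum of variables. -/

section Counting

variable {σ : Type*}

/-! Putting `xᵢ = |zᵢ|²` turns a diagonal `A` into a real polynomial `p`: being an SOS means having
nonnegative coefficients (`isSOS_realHerm_iff`), the rank is the number of terms (`rank_realHerm`),
and `‖z‖²` becomes `s = ∑ xᵢ`. So let `p` have a negative coefficient and `s * p` none, and count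
the terms of `s * p`.

The count is an induction on the number of variables (`cardBound`), for one homogeneous component of
`p`. Let `M l` be the least `x_l`-exponent of a negative term. If no term of `p` has `x_m`-exponent
`M m - 1`, then the terms of `s * p` at level `M m` come only from level `M m` of `p`, multiplied by
the other variables; induction applies to this slab, and three terms outside it suffice. They are
easy to find if `p` has terms below the slab (`IsSlab.card_support`). Otherwise, substituting `x_m =
-∑ i ≠ m, xᵢ` shows that either there are three anyway, or the slab is a difference of two powers
with enough terms of its own (`card_support_of_slab_zero`, `card_support_of_two_powers`).

If every level `M l - 1` is occupied, consider the terms of `p` below `M` in some coordinate. Three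
of them produce enough terms by their nearly disjoint shifts (`card_support_of_three_low`); with at
most two, a smaller slab still separates (`card_support_of_few_low`).

When `p` has no negative coefficient, shifts of up to three terms give the alternative for `n ≤ 6`,
where `κ₀ ≤ 2`. -/

lemma sub_single_add {β : σ →₀ ℕ} {i : σ} (h : β i ≠ 0) :
    β - Finsupp.single i 1 + Finsupp.single i 1 = β := by
  apply tsub_add_cancel_of_le
  rw [Finsupp.single_le_iff]
  omega

lemma single_one_injective : Function.Injective fun i : σ => (Finsupp.single i 1 : σ →₀ ℕ) :=
  Finsupp.single_left_injective one_ne_zero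

variable [DecidableEq σ]

/-- The sum of the variables indexed by `S`. -/
def linSum (S : Finset σ) : MvPolynomial σ ℝ := ∑ i ∈ S, X i

lemma coeff_linSum_mul (S : Finset σ) (p : MvPolynomial σ ℝ) (β : σ →₀ ℕ) :
    coeff β (linSum S * p) =
      ∑ i ∈ S, if β i ≠ 0 then coeff (β - Finsupp.single i 1) p else 0 := by
  simp only [linSum, Finset.sum_mul, coeff_sum, coeff_X_mul', Finsupp.mem_support_iff]

lemma coeff_linSum_mul_eq {S : Finset σ} {p : MvPolynomial σ ℝ} {π : σ →₀ ℕ} {i : σ}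
    (hi : i ∈ S) (h : ∀ j ∈ S, ∀ ν, j ≠ i → ν + Finsupp.single j 1 = π + Finsupp.single i 1 →
      coeff ν p = 0) :
    coeff (π + Finsupp.single i 1) (linSum S * p) = coeff π p := by
  rw [coeff_linSum_mul, Finset.sum_eq_single_of_mem i hi]
  · simp
  · intro j hj hji
    split_ifs with h0
    · exact h j hj _ hji (sub_single_add h0)
    · rfl

lemma coeff_linSum_mul_pos {S : Finset σ} {p : MvPolynomial σ ℝ} {π : σ →₀ ℕ} {i : σ}
    (hi : i ∈ S) (hπ : 0 < coeff π p)
    (h : ∀ j ∈ S, ∀ ν, ν + Finsupp.single j 1 = π + Finsupp.single i 1 → 0 ≤ coeff ν p) :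
    0 < coeff (π + Finsupp.single i 1) (linSum S * p) := by
  rw [coeff_linSum_mul]
  apply Finset.sum_pos'
  · intro j hj
    split_ifs with h0
    · exact h j hj _ (sub_single_add h0)
    · exact le_rfl
  · exact ⟨i, hi, by simpa using hπ⟩

lemma exists_of_mem_support_linSum_mul {S : Finset σ} {p : MvPolynomial σ ℝ} {β : σ →₀ ℕ}
    (h : β ∈ (linSum S * p).support) :
    ∃ α ∈ p.support, ∃ i ∈ S, α + Finsupp.single i 1 = β := by
  rw [mem_support_iff, coeff_linSum_mul] at h
  obtain ⟨i, hi, hne⟩ := Finset.exists_ne_zero_of_sum_ne_zero h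
  split_ifs at hne with h0
  · exact ⟨_, mem_support_iff.2 hne, i, hi, sub_single_add h0⟩
  · exact absurd rfl hne

open Classical in
/-- The part of a polynomial supported on the exponents satisfying `Q`. -/
def restrict (Q : (σ →₀ ℕ) → Prop) (p : MvPolynomial σ ℝ) : MvPolynomial σ ℝ :=
  ∑ α ∈ p.support.filter Q, monomial α (coeff α p)

open Classical in
lemma coeff_restrict (Q : (σ →₀ ℕ) → Prop) (p : MvPolynomial σ ℝ) (α : σ →₀ ℕ) :
    coeff α (restrict Q p) = if Q α then coeff α p else 0 := by
  rw [restrict, coeff_sum]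
  simp only [coeff_monomial]
  rw [Finset.sum_ite_eq']
  by_cases h : Q α <;> by_cases h' : coeff α p = 0 <;> simp [h, h']

open Classical in
/-- Multiplication by a sum of variables commutes with passing to parts which are separated from
the rest of the support. -/
lemma coeff_linSum_mul_restrict {S S' : Finset σ} (hS : S' ⊆ S) {p : MvPolynomial σ ℝ}
    {Q Q' : (σ →₀ ℕ) → Prop}
    (h : ∀ α ∈ p.support, ∀ i ∈ S, Q' (α + Finsupp.single i 1) ↔ Q α ∧ i ∈ S') (β : σ →₀ ℕ) :
    coeff β (linSum S' * restrict Q p) = if Q' β then coeff β (linSum S * p) else 0 := by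
  have key : coeff β (linSum S' * restrict Q p) =
      ∑ i ∈ S, if Q' β then (if β i ≠ 0 then coeff (β - Finsupp.single i 1) p else 0) else 0 := by
    rw [coeff_linSum_mul, ← Finset.inter_eq_right.2 hS, ← Finset.sum_ite_mem]
    refine Finset.sum_congr rfl fun i hi => ?_
    by_cases h0 : β i ≠ 0
    · by_cases hs : β - Finsupp.single i 1 ∈ p.support
      · have := h _ hs i hi
        rw [sub_single_add h0] at this
        by_cases h1 : Q (β - Finsupp.single i 1) <;> by_cases h2 : i ∈ S' <;>
          simp_all [coeff_restrict]
      · have hz := notMem_support_iff.1 hs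
        simp [coeff_restrict, hz]
    · simp [h0]
  rw [key]
  split_ifs with hQ
  · rw [coeff_linSum_mul]
  · simp

/-! ### Shifts of exponents and their overlaps. -/

/-- The exponents obtained from `u` by raising one of the variables in `F`. -/
def shifts (F : Finset σ) (u : σ →₀ ℕ) : Finset (σ →₀ ℕ) :=
  F.image fun i => u + Finsupp.single i 1

lemma mem_shifts {F : Finset σ} {u β : σ →₀ ℕ} :
    β ∈ shifts F u ↔ ∃ i ∈ F, u + Finsupp.single i 1 = β := by
  simp [shifts]

lemma card_shifts (F : Finset σ) (u : σ →₀ ℕ) : (shifts F u).card = F.card :=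
  Finset.card_image_of_injective _ fun _ _ h => single_one_injective (add_left_cancel h)

lemma apply_of_mem_shifts {F : Finset σ} {u β : σ →₀ ℕ} {l : σ} (h : β ∈ shifts (F.erase l) u) :
    β l = u l := by
  obtain ⟨i, hi, rfl⟩ := mem_shifts.1 h
  simp [(Finset.mem_erase.1 hi).1]

lemma le_apply_of_mem_shifts {F : Finset σ} {u β : σ →₀ ℕ} (l : σ) (h : β ∈ shifts F u) :
    u l ≤ β l := by
  obtain ⟨i, hi, rfl⟩ := mem_shifts.1 h
  simp

/-- A common shift `u + e_i = v + e_j` has `i ≠ j`, and the difference `u - v = e_j - e_i` then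
determines `i` and `j`. -/
lemma card_shifts_inter_le (F G : Finset σ) {u v : σ →₀ ℕ} (huv : u ≠ v) :
    (shifts F u ∩ shifts G v).card ≤ 1 := by
  rw [Finset.card_le_one]
  intro a ha b hb
  simp only [Finset.mem_inter, mem_shifts] at ha hb
  obtain ⟨⟨i, -, rfl⟩, ⟨j, -, hj⟩⟩ := ha
  obtain ⟨⟨k, -, rfl⟩, ⟨l, -, hl⟩⟩ := hb
  have hij : i ≠ j := fun h => huv (by subst h; exact (add_right_cancel hj).symm)
  have hkl : k ≠ l := fun h => huv (by subst h; exact (add_right_cancel hl).symm)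
  have hik : i = k := by
    by_contra hne
    have h1 := DFunLike.congr_fun hj i
    have h2 := DFunLike.congr_fun hl i
    simp only [Finsupp.add_apply, Finsupp.single_apply] at h1 h2
    simp only [if_true, if_neg hij.symm, if_neg (Ne.symm hne)] at h1 h2
    split_ifs at h2 <;> omega
  rw [hik]

lemma card_union_three {τ : Type*} [DecidableEq τ] {A B C U : Finset τ} {k : ℕ}
    (hA : k ≤ A.card) (hB : k ≤ B.card) (hC : k ≤ C.card)
    (hAU : A ⊆ U) (hBU : B ⊆ U) (hCU : C ⊆ U) {x y z : ℕ}
    (hAB : (A ∩ B).card ≤ x) (hAC : (A ∩ C).card ≤ y) (hBC : (B ∩ C).card ≤ z) :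
    3 * k ≤ U.card + x + y + z := by
  have h1 := Finset.card_union_add_card_inter B C
  have h2 := Finset.card_union_add_card_inter A (B ∪ C)
  have h3 : (A ∩ (B ∪ C)).card ≤ x + y := by
    rw [Finset.inter_union_distrib_left]
    exact (Finset.card_union_le _ _).trans (add_le_add hAB hAC)
  have h4 : (A ∪ (B ∪ C)).card ≤ U.card :=
    Finset.card_le_card (Finset.union_subset hAU (Finset.union_subset hBU hCU))
  omega

/-- A nonzero term of highest degree in a variable. -/
lemma exists_top_mem_support {S : Finset σ} {p : MvPolynomial σ ℝ} (hp : p ≠ 0) {l : σ}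
    (hl : l ∈ S) :
    ∃ β ∈ (linSum S * p).support, ∀ α ∈ p.support, α l < β l := by
  obtain ⟨α, hα, hmax⟩ := p.support.exists_max_image (fun α => α l)
    (Finset.nonempty_of_ne_empty fun h => hp (support_eq_empty.1 h))
  refine ⟨α + Finsupp.single l 1, ?_, fun α' hα' => ?_⟩
  · rw [mem_support_iff, coeff_linSum_mul_eq hl]
    · exact mem_support_iff.1 hα
    · intro j hj ν hjl hν
      by_contra hne
      have h1 := hmax ν (mem_support_iff.2 hne)
      have h2 := DFunLike.congr_fun hν l
      simp [hjl] at h2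
      omega
  · have := hmax α' hα'
    simp
    omega

/-! ### Powers of a sum of variables. -/

omit [DecidableEq σ] in
lemma coeff_mul_nonneg {f g : MvPolynomial σ ℝ} (hf : ∀ α, 0 ≤ coeff α f)
    (hg : ∀ α, 0 ≤ coeff α g) (α : σ →₀ ℕ) : 0 ≤ coeff α (f * g) := by
  classical
  rw [coeff_mul]
  exact Finset.sum_nonneg fun x _ => mul_nonneg (hf _) (hg _)

omit [DecidableEq σ] in
lemma coeff_monomial_nonneg {a : ℝ} (ha : 0 ≤ a) (α δ : σ →₀ ℕ) :
    0 ≤ coeff δ (monomial α a) := by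
  classical
  rw [coeff_monomial]
  split_ifs <;> simp [ha]

omit [DecidableEq σ] in
lemma coeff_linSum_nonneg (S : Finset σ) (δ : σ →₀ ℕ) : 0 ≤ coeff δ (linSum S) := by
  rw [linSum, coeff_sum]
  exact Finset.sum_nonneg fun i _ => coeff_monomial_nonneg zero_le_one _ _

omit [DecidableEq σ] in
lemma coeff_linSum_pow_nonneg (S : Finset σ) (J : ℕ) (δ : σ →₀ ℕ) :
    0 ≤ coeff δ (linSum S ^ J) := by
  induction J generalizing δ with
  | zero => exact coeff_monomial_nonneg zero_le_one 0 δ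
  | succ J ih =>
    rw [pow_succ']
    exact coeff_mul_nonneg (coeff_linSum_nonneg S) ih δ

lemma sum_add_single {S : Finset σ} {i : σ} (hi : i ∈ S) (α : σ →₀ ℕ) :
    ∑ j ∈ S, (α + Finsupp.single i 1 : σ →₀ ℕ) j = ∑ j ∈ S, α j + 1 := by
  simp [Finset.sum_add_distrib, Finsupp.single_apply, hi]

lemma support_linSum_pow {S : Finset σ} {J : ℕ} {δ : σ →₀ ℕ}
    (h : coeff δ (linSum S ^ J) ≠ 0) : (∀ i, i ∉ S → δ i = 0) ∧ ∑ i ∈ S, δ i = J := by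
  induction J generalizing δ with
  | zero =>
    have : δ = 0 := by
      by_contra hne
      exact h (by rw [pow_zero, coeff_one, if_neg (Ne.symm hne)])
    subst this
    simp
  | succ J ih =>
    rw [pow_succ'] at h
    obtain ⟨α, hα, i, hi, rfl⟩ := exists_of_mem_support_linSum_mul (mem_support_iff.2 h)
    obtain ⟨h1, h2⟩ := ih (mem_support_iff.1 hα)
    refine ⟨fun j hj => ?_, by rw [sum_add_single hi, h2]⟩
    have : i ≠ j := fun h => hj (h ▸ hi)
    simp [h1 j hj, this]

lemma coeff_linSum_pow_pos {S : Finset σ} {J : ℕ} {δ : σ →₀ ℕ} (h1 : ∀ i, i ∉ S → δ i = 0)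
    (h2 : ∑ i ∈ S, δ i = J) : 0 < coeff δ (linSum S ^ J) := by
  induction J generalizing δ with
  | zero =>
    have : δ = 0 := by
      ext i
      by_cases hi : i ∈ S
      · exact (Finset.sum_eq_zero_iff.1 h2) i hi
      · exact h1 i hi
    simp [this]
  | succ J ih =>
    obtain ⟨i, hi, hne⟩ := Finset.exists_ne_zero_of_sum_ne_zero (by rw [h2]; omega :
      ∑ i ∈ S, δ i ≠ 0)
    have hδ := sub_single_add hne
    rw [pow_succ', ← hδ]
    refine coeff_linSum_mul_pos hi (ih (fun j hj => ?_) ?_)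
      fun j _ ν _ => coeff_linSum_pow_nonneg S J ν
    · simp [h1 j hj]
    · have := sum_add_single hi (δ - Finsupp.single i 1)
      rw [hδ, h2] at this
      omega

lemma coeff_single_linSum_pow {S : Finset σ} {l : σ} (hl : l ∈ S) (J : ℕ) :
    coeff (Finsupp.single l J) (linSum S ^ J) = 1 := by
  induction J with
  | zero => simp
  | succ J ih =>
    rw [pow_succ', Finsupp.single_add, coeff_linSum_mul_eq hl, ih]
    intro j _ ν hjl hν
    have := DFunLike.congr_fun hν j
    simp [hjl] at this

lemma coeff_linSum_pow_sub_X_pow_nonneg {S : Finset σ} {l : σ} (hl : l ∈ S) (J : ℕ)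
    (δ : σ →₀ ℕ) : 0 ≤ coeff δ (linSum S ^ J - X l ^ J) := by
  induction J generalizing δ with
  | zero => simp
  | succ J ih =>
    have h : linSum S ^ (J + 1) - X l ^ (J + 1) =
        linSum (S.erase l) * linSum S ^ J + X l * (linSum S ^ J - X l ^ J) := by
      have : linSum S = X l + linSum (S.erase l) := (Finset.add_sum_erase S _ hl).symm
      rw [pow_succ', pow_succ']
      nth_rewrite 1 [this]
      ring
    rw [h, coeff_add]
    exact add_nonneg (coeff_mul_nonneg (coeff_linSum_nonneg _) (coeff_linSum_pow_nonneg S J) δ)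
      (coeff_mul_nonneg (fun α => coeff_monomial_nonneg zero_le_one _ α) ih δ)

omit [DecidableEq σ] in
lemma sum_single_of_mem {S : Finset σ} {l : σ} (hl : l ∈ S) (J : ℕ) :
    ∑ i ∈ S, (Finsupp.single l J : σ →₀ ℕ) i = J := by
  classical
  simp [Finsupp.single_apply, hl]

lemma linSum_ne_zero {S : Finset σ} (hS : S.Nonempty) : linSum S ≠ 0 := by
  obtain ⟨l, hl⟩ := hS
  intro h
  have := coeff_single_linSum_pow hl 1
  rw [pow_one, h] at this
  simp at this

/-! ### The case in which the slab is the lowest level of the polynomial. -/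

/-- There are many monomials of degree `J` in the variables from `S` which are not divisible by a
given monomial that involves two variables and is not their product. -/
lemma card_not_dvd {S : Finset σ} {u v : σ} (hu : u ∈ S) (hv : v ∈ S) (huv : u ≠ v)
    {γ : σ →₀ ℕ} (hγu : γ u ≠ 0) (hγv : γ v ≠ 0)
    (hγ : γ ≠ Finsupp.single u 1 + Finsupp.single v 1) {J : ℕ} (hJ : 3 ≤ J)
    {U : Finset (σ →₀ ℕ)}
    (hU : ∀ δ : σ →₀ ℕ, (∀ i, i ∉ S → δ i = 0) → ∑ i ∈ S, δ i = J → ¬ γ ≤ δ → δ ∈ U) :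
    3 * S.card ≤ U.card + 3 := by
  set T := (S.erase u).erase v with hT
  have hTc : T.card + 2 = S.card := by
    rw [hT, Finset.card_erase_of_mem (Finset.mem_erase.2 ⟨huv.symm, hv⟩),
      Finset.card_erase_of_mem hu]
    have : 1 < S.card := Finset.one_lt_card.2 ⟨u, hu, v, hv, huv⟩
    omega
  have hTm : ∀ m ∈ T, m ≠ v ∧ m ≠ u ∧ m ∈ S := fun m hm => by simpa [hT] using hm
  have hzero : ∀ (x y : σ) (a b : ℕ), x ∈ S → y ∈ S → ∀ i, i ∉ S →
      (Finsupp.single x a + Finsupp.single y b) i = 0 := by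
    intro x y a b hx hy i hi
    have h1 : x ≠ i := fun h => hi (h ▸ hx)
    have h2 : y ≠ i := fun h => hi (h ▸ hy)
    simp [h1, h2]
  have hsum : ∀ (x y : σ) (a b : ℕ), x ∈ S → y ∈ S →
      ∑ i ∈ S, (Finsupp.single x a + Finsupp.single y b) i = a + b := by
    intro x y a b hx hy
    simp only [Finsupp.add_apply, Finset.sum_add_distrib]
    rw [sum_single_of_mem hx, sum_single_of_mem hy]
  -- Every exponent in these three families misses `u` or `v`, hence is not divisible by `γ`. They
  -- have `|S| + 2(|S| - 2)` members; one more involving both `u` and `v` gives `3|S| - 3`.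
  let D1 := S.image fun i => Finsupp.single i J
  let D2 := T.image fun m => Finsupp.single v (J - 1) + Finsupp.single m 1
  let D3 := T.image fun m => Finsupp.single v (J - 2) + Finsupp.single m 2
  -- If `γ u ≥ 2`, take `u`-exponent `1`. Otherwise `γ u = 1`, and `γ` could divide `u^(J-1) v` only
  -- if it were `u v`.
  have h4 : ∃ δ ∈ U, δ u ≠ 0 ∧ δ v ≠ 0 := by
    by_cases h2 : 2 ≤ γ u
    · refine ⟨Finsupp.single u 1 + Finsupp.single v (J - 1),
        hU _ (hzero _ _ _ _ hu hv) (by rw [hsum _ _ _ _ hu hv]; omega) fun h => ?_, ?_, ?_⟩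
      · have := h u
        simp [huv.symm] at this
        omega
      · simp
      · simp [huv]; omega
    · refine ⟨Finsupp.single u (J - 1) + Finsupp.single v 1,
        hU _ (hzero _ _ _ _ hu hv) (by rw [hsum _ _ _ _ hu hv]; omega) fun h => ?_, ?_, ?_⟩
      · apply hγ
        ext i
        have hi := h i
        by_cases h1 : u = i
        · subst h1
          simp [huv.symm]
          omega
        · by_cases h3 : v = i
          · subst h3
            simp [huv] at hi ⊢
            omega
          · simp [h1, h3] at hi ⊢
            omega
      · simp [huv.symm]; omega
      · simp
  obtain ⟨δ, hδU, hδu, hδv⟩ := h4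
  have hc1 : D1.card = S.card := Finset.card_image_of_injective _
    (Finsupp.single_left_injective (by omega))
  have hc2 : D2.card = T.card := Finset.card_image_of_injective _ fun _ _ h =>
    single_one_injective (add_left_cancel h)
  have hc3 : D3.card = T.card := Finset.card_image_of_injective _ fun _ _ h =>
    Finsupp.single_left_injective two_ne_zero (add_left_cancel h)
  have hd23 : Disjoint D2 D3 := by
    rw [Finset.disjoint_left]
    intro x hx hx'
    obtain ⟨m, hm, rfl⟩ := Finset.mem_image.1 hx
    obtain ⟨m', hm', h⟩ := Finset.mem_image.1 hx'
    have := DFunLike.congr_fun h v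
    simp [(hTm m hm).1, (hTm m' hm').1] at this
    omega
  have hd1 : Disjoint D1 (D2 ∪ D3) := by
    rw [Finset.disjoint_left]
    intro x hx hx'
    obtain ⟨i, hi, rfl⟩ := Finset.mem_image.1 hx
    rcases Finset.mem_union.1 hx' with hx' | hx' <;>
    · obtain ⟨m, hm, h⟩ := Finset.mem_image.1 hx'
      have h1 := DFunLike.congr_fun h v
      have h2 := DFunLike.congr_fun h m
      have hmv := (hTm m hm).1
      simp [hmv, hmv.symm, Finsupp.single_apply] at h1 h2
      split_ifs at h1 h2 <;> omega
  have hdδ : δ ∉ D1 ∪ (D2 ∪ D3) := by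
    intro h
    rcases Finset.mem_union.1 h with h | h
    · obtain ⟨i, -, rfl⟩ := Finset.mem_image.1 h
      simp only [Finsupp.single_apply] at hδu hδv
      split_ifs at hδu hδv with h1 h2
      · exact huv (h1.symm.trans h2)
      all_goals simp at hδu hδv
    · rcases Finset.mem_union.1 h with h | h <;>
      · obtain ⟨m, hm, rfl⟩ := Finset.mem_image.1 h
        simp [huv.symm, (hTm m hm).2.1] at hδu
  have hsub : insert δ (D1 ∪ (D2 ∪ D3)) ⊆ U := by
    intro x hx
    rcases Finset.mem_insert.1 hx with rfl | hx
    · exact hδU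
    rcases Finset.mem_union.1 hx with hx | hx
    · obtain ⟨i, hi, rfl⟩ := Finset.mem_image.1 hx
      refine hU _ (fun j hj => ?_) (sum_single_of_mem hi J) fun h => ?_
      · have : i ≠ j := fun h => hj (h ▸ hi)
        simp [this]
      · by_cases hiu : i = u
        · subst hiu
          have := h v
          simp [huv] at this
          exact hγv this
        · have := h u
          simp [hiu] at this
          exact hγu this
    · rcases Finset.mem_union.1 hx with hx | hx <;>
      · obtain ⟨m, hm, rfl⟩ := Finset.mem_image.1 hx
        obtain ⟨hmv, hmu, hmS⟩ := hTm m hm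
        refine hU _ (hzero _ _ _ _ hv hmS) (by rw [hsum _ _ _ _ hv hmS]; omega) fun h => ?_
        have := h u
        simp [huv.symm, hmu] at this
        exact hγu this
  have := Finset.card_le_card hsub
  rw [Finset.card_insert_of_notMem hdδ, Finset.card_union_of_disjoint hd1,
    Finset.card_union_of_disjoint hd23, hc1, hc2, hc3] at this
  omega

/-- The subtracted power must be covered by the other one, which forces `β = α + γ` with `γ` of odd
degree `j - k`. If `γ` were a pure power, `r` would have nonnegative coefficients; so `γ` involves
two variables, and by parity is not their product. Every monomial of degree `j + 1` not divisible by
`γ` then survives the subtraction, and `card_not_dvd` counts these. -/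
lemma card_support_of_two_powers {S : Finset σ} (hS : 2 ≤ S.card) {r : MvPolynomial σ ℝ}
    {a b : ℝ} (ha : 0 < a) (hb : 0 < b) {α β : σ →₀ ℕ} {j k : ℕ} (hj : Even j) (hk : Odd k)
    (h : linSum S * r = monomial α a * linSum S ^ (j + 1) - monomial β b * linSum S ^ (k + 1))
    (hneg : ∃ δ, coeff δ r < 0) (hpos : ∀ δ, 0 ≤ coeff δ (linSum S * r)) :
    3 * S.card ≤ (linSum S * r).support.card + 3 := by
  have hne : S.Nonempty := Finset.card_pos.1 (by omega)
  have hcoeff : ∀ δ, coeff δ (linSum S * r) =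
      (if α ≤ δ then a * coeff (δ - α) (linSum S ^ (j + 1)) else 0) -
      (if β ≤ δ then b * coeff (δ - β) (linSum S ^ (k + 1)) else 0) := by
    intro δ
    rw [h, coeff_sub, coeff_monomial_mul', coeff_monomial_mul']
  have hr : r = monomial α a * linSum S ^ j - monomial β b * linSum S ^ k := by
    apply mul_left_cancel₀ (linSum_ne_zero hne)
    rw [h]
    ring
  -- At a vertex of the second power the coefficient `-b` has to be compensated by the first.
  have hvertex : ∀ l ∈ S, α ≤ β + Finsupp.single l (k + 1) ∧
      coeff (β + Finsupp.single l (k + 1) - α) (linSum S ^ (j + 1)) ≠ 0 := by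
    intro l hl
    have h1 := hpos (β + Finsupp.single l (k + 1))
    rw [hcoeff, if_pos le_self_add, add_tsub_cancel_left, coeff_single_linSum_pow hl] at h1
    split_ifs at h1 with h2
    · refine ⟨h2, fun h0 => ?_⟩
      rw [h0] at h1
      linarith
    · linarith
  obtain ⟨l₁, hl₁, l₂, hl₂, hl⟩ := Finset.one_lt_card.1 hS
  have hαβ : α ≤ β := by
    intro i
    by_cases hi : l₁ = i
    · have := (hvertex l₂ hl₂).1 i
      have h' : l₂ ≠ i := fun h => hl (hi.trans h.symm)
      simpa [h'] using this
    · have := (hvertex l₁ hl₁).1 i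
      simpa [hi] using this
  obtain ⟨γ, rfl⟩ := exists_add_of_le hαβ
  have hγ : (∀ i, i ∉ S → γ i = 0) ∧ ∑ i ∈ S, γ i = j - k ∧ k ≤ j := by
    obtain ⟨h1, h2⟩ := support_linSum_pow (hvertex l₁ hl₁).2
    rw [add_assoc, add_tsub_cancel_left] at h1 h2
    refine ⟨fun i hi => ?_, ?_⟩
    · have := h1 i hi
      simp at this
      exact this.1
    · simp only [Finsupp.add_apply, Finset.sum_add_distrib] at h2
      rw [sum_single_of_mem hl₁] at h2
      omega
  obtain ⟨hγS, hγsum, hkj⟩ := hγ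
  have hodd : Odd (j - k) := Nat.Even.sub_odd hkj hj hk
  have hk0 : 0 < k := hk.pos
  have hg0 : 0 < j - k := hodd.pos
  obtain ⟨u, hu, hγu⟩ := Finset.exists_ne_zero_of_sum_ne_zero (by rw [hγsum]; omega :
      ∑ i ∈ S, γ i ≠ 0)
  have hv : ∃ v ∈ S, u ≠ v ∧ γ v ≠ 0 := by
    by_contra! hcon
    have hγ1 : γ = Finsupp.single u (j - k) := by
      ext i
      by_cases hi : u = i
      · subst hi
        rw [← hγsum, Finset.sum_eq_single_of_mem u hu fun b hb hbu => hcon b hb hbu.symm]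
        simp
      · by_cases hiS : i ∈ S
        · simp [hcon i hiS hi, hi]
        · simp [hγS i hiS, hi]
    have hab : b ≤ a := by
      have h1 := hpos (α + Finsupp.single u (j + 1))
      have h2 : Finsupp.single u (j + 1) =
          γ + (Finsupp.single u (k + 1) : σ →₀ ℕ) := by
        rw [hγ1, ← Finsupp.single_add]
        congr 1
        omega
      rw [hcoeff, if_pos le_self_add, add_tsub_cancel_left, coeff_single_linSum_pow hu, h2,
        ← add_assoc, if_pos le_self_add, add_tsub_cancel_left, coeff_single_linSum_pow hu] at h1
      linarith
    obtain ⟨δ, hδ⟩ := hneg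
    have hX : monomial (α + γ) b = monomial α 1 * (C b * X u ^ (j - k)) := by
      rw [hγ1, X_pow_eq_monomial, C_mul_monomial, monomial_mul]
      simp
    have hA : monomial α a = monomial α 1 * C a := by
      rw [mul_comm, C_mul_monomial, mul_one]
    -- Each factor has nonnegative coefficients: `b ≤ a`, and `x_u^(j-k)` is one of the terms of
    -- `s^(j-k)`.
    have hr' : r = monomial α 1 * ((C (a - b) * linSum S ^ (j - k) +
        C b * (linSum S ^ (j - k) - X u ^ (j - k))) * linSum S ^ k) := by
      have : linSum S ^ j = linSum S ^ (j - k) * linSum S ^ k := by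
        rw [← pow_add]
        congr 1
        omega
      rw [hr, hX, hA, this, C_sub]
      ring
    have h0 : 0 ≤ coeff δ r := by
      rw [hr']
      refine coeff_mul_nonneg (coeff_monomial_nonneg zero_le_one _)
        (coeff_mul_nonneg (fun δ => ?_) (coeff_linSum_pow_nonneg S k)) δ
      rw [coeff_add, coeff_C_mul, coeff_C_mul]
      exact add_nonneg (mul_nonneg (sub_nonneg.2 hab) (coeff_linSum_pow_nonneg _ _ _))
        (mul_nonneg hb.le (coeff_linSum_pow_sub_X_pow_nonneg hu _ _))
    linarith
  obtain ⟨v, hv, huv, hγv⟩ := hv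
  have hγuv : γ ≠ Finsupp.single u 1 + Finsupp.single v 1 := by
    intro h1
    rw [h1] at hγsum
    simp only [Finsupp.add_apply, Finset.sum_add_distrib] at hγsum
    rw [sum_single_of_mem hu, sum_single_of_mem hv] at hγsum
    rw [← hγsum] at hodd
    exact absurd hodd (by decide)
  have hJ : 3 ≤ j + 1 := by
    have h1 := Finset.add_le_sum (f := fun i => γ i) (fun i _ => Nat.zero_le _) hu hv huv
    have h2 : γ u + γ v ≤ j - k := hγsum ▸ h1
    omega
  refine (card_not_dvd hu hv huv hγu hγv hγuv hJ
    (U := (linSum S * r).support.image fun x => x - α) fun δ h1 h2 h3 => ?_).trans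
    (Nat.add_le_add_right Finset.card_image_le 3)
  refine Finset.mem_image.2 ⟨α + δ, ?_, add_tsub_cancel_left _ _⟩
  rw [mem_support_iff, hcoeff, if_pos le_self_add, add_tsub_cancel_left,
    if_neg (fun h => h3 (le_of_add_le_add_left h)), sub_zero]
  exact (mul_pos ha (coeff_linSum_pow_pos h1 h2)).ne'

/-- Substituting `-∑ i ∈ S.erase m, X i` for `X m` in a multiple of `linSum S`. -/
lemma linSum_erase_mul_restrict {S : Finset σ} {m : σ} (hm : m ∈ S) (p : MvPolynomial σ ℝ) :
    linSum (S.erase m) * restrict (fun α => α m = 0) p =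
      ∑ β ∈ (linSum S * p).support with β m ≠ 0,
        monomial (β.erase m) (-coeff β (linSum S * p)) * (-linSum (S.erase m)) ^ β m := by
  set s := linSum (S.erase m) with hs
  set q := linSum S * p with hq
  let φ : MvPolynomial σ ℝ →ₐ[ℝ] MvPolynomial σ ℝ := aeval (Function.update X m (-s))
  have hφs : φ (linSum S) = 0 := by
    rw [linSum, ← Finset.add_sum_erase S _ hm, map_add, map_sum]
    simp only [φ, aeval_X, Function.update_self]
    rw [hs, linSum, neg_add_eq_zero]
    refine Finset.sum_congr rfl fun i hi => ?_
    rw [Function.update_of_ne (Finset.ne_of_mem_erase hi)]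
  have hφq : φ q = 0 := by rw [hq, map_mul, hφs, zero_mul]
  have hφm : ∀ (β : σ →₀ ℕ) (b : ℝ), φ (monomial β b) = monomial (β.erase m) b * (-s) ^ β m := by
    intro β b
    rw [aeval_monomial, ← Finsupp.mul_prod_erase' β m _ (fun i => pow_zero _),
      Function.update_self, monomial_eq, algebraMap_eq]
    have : (β.erase m).prod (fun i k => Function.update X m (-s) i ^ k) =
        (β.erase m).prod (fun i k => (X i : MvPolynomial σ ℝ) ^ k) := by
      refine Finsupp.prod_congr fun i hi => ?_
      rw [Function.update_of_ne]
      rintro rfl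
      simp at hi
    rw [this]
    ring
  have hres : s * restrict (fun α => α m = 0) p =
      ∑ β ∈ q.support with β m = 0, monomial β (coeff β q) := by
    have : s * restrict (fun α => α m = 0) p = restrict (fun α => α m = 0) q := by
      ext β
      rw [coeff_restrict, coeff_linSum_mul_restrict (Finset.erase_subset m S)]
      intro α _ i hi
      rcases eq_or_ne i m with rfl | h
      · simp
      · simp [h, hi]
    rw [this, restrict]
    congr!
  rw [q.as_sum, map_sum, ← Finset.sum_filter_add_sum_filter_not _ (fun β => β m = 0)] at hφq
  rw [hres, ← sub_eq_zero, ← hφq, sub_eq_add_neg, ← Finset.sum_neg_distrib]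
  congr 1
  · refine Finset.sum_congr rfl fun β hβ => ?_
    have h0 : β m = 0 := (Finset.mem_filter.1 hβ).2
    rw [hφm, h0, pow_zero, mul_one, Finsupp.erase_of_notMem_support (by simpa using h0)]
  · refine Finset.sum_congr rfl fun β _ => ?_
    rw [hφm, map_neg, neg_mul, neg_neg]

/-- If the part of `p` not divisible by `X m` has a negative coefficient, then a product
`linSum S * p` with nonnegative coefficients has many terms. -/
lemma card_support_of_slab_zero {S : Finset σ} {m : σ} (hm : m ∈ S) (hS : 3 ≤ S.card)
    {p : MvPolynomial σ ℝ} (hpos : ∀ β, 0 ≤ coeff β (linSum S * p))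
    (hneg : ∃ ν, ν m = 0 ∧ coeff ν p < 0)
    (hslab : 3 * (S.erase m).card ≤ {β ∈ (linSum S * p).support | β m = 0}.card + 4) :
    3 * S.card ≤ (linSum S * p).support.card + 4 := by
  have hcard := Finset.card_filter_add_card_filter_not (s := (linSum S * p).support)
    (fun β => β m = 0)
  have hSm := Finset.card_erase_of_mem hm
  by_cases h3 : 3 ≤ {β ∈ (linSum S * p).support | ¬ β m = 0}.card
  · omega
  have hsub := linSum_erase_mul_restrict hm p
  have hrcoeff : ∀ β, coeff β (linSum (S.erase m) * restrict (fun α => α m = 0) p) =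
      if β m = 0 then coeff β (linSum S * p) else 0 := by
    intro β
    rw [coeff_linSum_mul_restrict (Finset.erase_subset m S) (Q' := fun β => β m = 0)]
    · by_cases h : β m = 0 <;> simp [h]
    intro α _ i hi
    rcases eq_or_ne i m with rfl | h
    · simp
    · simp [h, hi]
  set s := linSum (S.erase m)
  set r := restrict (fun α => α m = 0) p
  set W := {β ∈ (linSum S * p).support | ¬ β m = 0} with hW
  have hs0 : s ≠ 0 := linSum_ne_zero (Finset.card_pos.1 (by omega))
  have hrpos : ∀ β, 0 ≤ coeff β (s * r) := by
    intro β
    rw [hrcoeff]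
    split_ifs
    exacts [hpos β, le_rfl]
  have hrneg : ∃ δ, coeff δ r < 0 := by
    obtain ⟨ν, h0, h1⟩ := hneg
    exact ⟨ν, by rwa [coeff_restrict, if_pos h0]⟩
  have hWpos : ∀ β ∈ W, 0 < coeff β (linSum S * p) := fun β hβ =>
    lt_of_le_of_ne (hpos β) (Ne.symm (mem_support_iff.1 (Finset.mem_filter.1 hβ).1))
  have hW0 : ∀ β ∈ W, β m ≠ 0 := fun β hβ => (Finset.mem_filter.1 hβ).2
  -- With only odd exponents, `-(-s)^(β m) = s^(β m)`; cancelling one factor `s` would make `r`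
  -- nonnegative.
  have heven : ∃ β ∈ W, Even (β m) := by
    by_contra! hodd
    obtain ⟨δ, hδ⟩ := hrneg
    have : r = ∑ β ∈ W, monomial (β.erase m) (coeff β (linSum S * p)) * s ^ (β m - 1) := by
      apply mul_left_cancel₀ hs0
      rw [hsub, Finset.mul_sum]
      refine Finset.sum_congr rfl fun β hβ => ?_
      have ho : Odd (β m) := Nat.not_even_iff_odd.1 (hodd β hβ)
      obtain ⟨k, hk⟩ := Nat.exists_eq_succ_of_ne_zero (hW0 β hβ)
      rw [ho.neg_pow, hk, map_neg, Nat.succ_eq_add_one, Nat.add_sub_cancel, pow_succ]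
      ring
    rw [this, coeff_sum] at hδ
    refine absurd hδ (not_lt.2 (Finset.sum_nonneg fun β hβ => ?_))
    exact coeff_mul_nonneg (coeff_monomial_nonneg (hpos β) _) (coeff_linSum_pow_nonneg _ _) δ
  -- With only even exponents, `s * r` would be both nonnegative and nonpositive, so `r = 0`.
  have hodd : ∃ β ∈ W, Odd (β m) := by
    by_contra! hev
    obtain ⟨δ, hδ⟩ := hrneg
    have hz : s * r = 0 := by
      ext δ
      refine le_antisymm ?_ (hrpos δ)
      rw [hsub, coeff_sum]
      refine Finset.sum_nonpos fun β hβ => ?_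
      have he : Even (β m) := Nat.not_odd_iff_even.1 (hev β hβ)
      rw [he.neg_pow, map_neg, neg_mul, coeff_neg]
      exact neg_nonpos.2 (coeff_mul_nonneg (coeff_monomial_nonneg (hpos β) _)
        (coeff_linSum_pow_nonneg _ _) δ)
    rw [(mul_eq_zero.1 hz).resolve_left hs0, coeff_zero] at hδ
    exact lt_irrefl _ hδ
  obtain ⟨β₂, hβ₂, he⟩ := heven
  obtain ⟨β₁, hβ₁, ho⟩ := hodd
  have hne : β₁ ≠ β₂ := fun h => Nat.not_even_iff_odd.2 ho (h ▸ he)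
  have hW2 : W = {β₁, β₂} := by
    refine (Finset.eq_of_subset_of_card_le ?_ ?_).symm
    · simp [Finset.insert_subset_iff, hβ₁, hβ₂]
    · rw [Finset.card_pair hne]
      omega
  obtain ⟨j, hj⟩ := Nat.exists_eq_succ_of_ne_zero (hW0 β₁ hβ₁)
  obtain ⟨k, hk⟩ := Nat.exists_eq_succ_of_ne_zero (hW0 β₂ hβ₂)
  have hform : s * r = monomial (β₁.erase m) (coeff β₁ (linSum S * p)) * s ^ (j + 1) -
      monomial (β₂.erase m) (coeff β₂ (linSum S * p)) * s ^ (k + 1) := by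
    change s * r = ∑ β ∈ W, _ at hsub
    rw [hsub, hW2, Finset.sum_pair hne, ho.neg_pow, he.neg_pow, hj, hk, map_neg, map_neg,
      Nat.succ_eq_add_one, Nat.succ_eq_add_one]
    ring
  -- The slab contributes `3(|S| - 1) - 3` terms, one better than the assumed slab bound, so the two
  -- terms of `W` suffice.
  have hmain := card_support_of_two_powers (S := S.erase m) (by omega) (hWpos _ hβ₁)
    (hWpos _ hβ₂) (by rw [hj] at ho; simpa [parity_simps] using ho)
    (by rw [hk] at he; simpa [parity_simps] using he) hform hrneg hrpos
  have hsupp : (s * r).support = {β ∈ (linSum S * p).support | β m = 0} := by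
    ext β
    rw [mem_support_iff, hrcoeff, Finset.mem_filter, mem_support_iff]
    by_cases h : β m = 0 <;> simp [h]
  have hWc : W.card = 2 := by rw [hW2, Finset.card_pair hne]
  change 3 * (S.erase m).card ≤ (s * r).support.card + 3 at hmain
  rw [hsupp] at hmain
  omega

/-- Dividing `p` by `x_m ^ M` reduces this to level zero. -/
lemma card_support_of_lowest_slab {S : Finset σ} {m : σ} (hm : m ∈ S) (hS : 3 ≤ S.card)
    {p : MvPolynomial σ ℝ} (hpos : ∀ β, 0 ≤ coeff β (linSum S * p)) {M : ℕ}
    (hM : ∀ α ∈ p.support, M ≤ α m) (hneg : ∃ ν, ν m = M ∧ coeff ν p < 0)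
    (hslab : 3 * (S.erase m).card ≤ {β ∈ (linSum S * p).support | β m = M}.card + 4) :
    3 * S.card ≤ (linSum S * p).support.card + 4 := by
  set e : σ →₀ ℕ := Finsupp.single m M with he
  have hle : ∀ α : σ →₀ ℕ, e ≤ α ↔ M ≤ α m := fun α => Finsupp.single_le_iff
  set p' := p.divMonomial e with hp'
  have hp : p = monomial e 1 * p' := by
    ext α
    rw [coeff_monomial_mul', one_mul]
    split_ifs with h
    · rw [hp', coeff_divMonomial, add_tsub_cancel_of_le h]
    · rw [← notMem_support_iff]
      exact fun hα => h ((hle α).2 (hM α hα))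
  have hq : linSum S * p = monomial e 1 * (linSum S * p') := by
    rw [hp]
    ring
  have hcoeff : ∀ β, coeff (e + β) (linSum S * p) = coeff β (linSum S * p') := fun β => by
    rw [hq, coeff_monomial_mul, one_mul]
  have hsupp : (linSum S * p).support = (linSum S * p').support.map (addLeftEmbedding e) := by
    ext β
    simp only [Finset.mem_map, addLeftEmbedding_apply]
    constructor
    · intro h
      have hβ : e ≤ β := by
        by_contra hcon
        rw [mem_support_iff, hq, coeff_monomial_mul', if_neg hcon] at h
        exact h rfl
      obtain ⟨γ, rfl⟩ := exists_add_of_le hβ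
      rw [mem_support_iff, hcoeff] at h
      exact ⟨γ, mem_support_iff.2 h, rfl⟩
    · rintro ⟨γ, hγ, rfl⟩
      rwa [mem_support_iff, hcoeff, ← mem_support_iff]
  have hm' : ∀ β : σ →₀ ℕ, (e + β) m = M ↔ β m = 0 := fun β => by simp [he]
  rw [hsupp, Finset.filter_map, Finset.card_map] at hslab
  rw [hsupp, Finset.card_map]
  refine card_support_of_slab_zero hm hS (fun β => by rw [← hcoeff]; exact hpos _) ?_ ?_
  · obtain ⟨ν, h1, h2⟩ := hneg
    obtain ⟨γ, rfl⟩ := exists_add_of_le ((hle ν).2 h1.ge)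
    exact ⟨γ, (hm' γ).1 h1, by rwa [hp', coeff_divMonomial]⟩
  · convert hslab using 4
    simp [he]

/-! ### Slabs and the induction on the number of variables. -/

/-- The support of `p` splits off a slab on which multiplication by `linSum S` acts as
multiplication by `linSum (S.erase m)`. -/
structure IsSlab (S : Finset σ) (p : MvPolynomial σ ℝ) (m : σ) (M : ℕ)
    (Q : (σ →₀ ℕ) → Prop) : Prop where
  level : ∀ α, Q α → α m = M
  iff : ∀ α ∈ p.support, ∀ i ∈ S, Q (α + Finsupp.single i 1) ↔ Q α ∧ i ≠ m
  neg : ∃ ν, Q ν ∧ coeff ν p < 0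

/-- The bound for the number of terms in dimension `k`. -/
def CardBound (σ : Type*) [DecidableEq σ] (k : ℕ) : Prop :=
  ∀ (S : Finset σ), S.card = k → ∀ (p : MvPolynomial σ ℝ) (d : ℕ),
    (∀ α ∈ p.support, ∑ i ∈ S, α i = d) → (∃ ν, coeff ν p < 0) →
    (∀ β, 0 ≤ coeff β (linSum S * p)) → 3 * S.card ≤ (linSum S * p).support.card + 4

open Classical in
lemma IsSlab.card_le {S : Finset σ} {p : MvPolynomial σ ℝ} {m : σ} {M : ℕ}
    {Q : (σ →₀ ℕ) → Prop} (hQ : IsSlab S p m M Q) (hm : m ∈ S) {d : ℕ}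
    (hd : ∀ α ∈ p.support, ∑ i ∈ S, α i = d) (hpos : ∀ β, 0 ≤ coeff β (linSum S * p))
    (ih : CardBound σ (S.erase m).card) :
    3 * (S.erase m).card ≤ {β ∈ (linSum S * p).support | Q β}.card + 4 := by
  have hcoeff : ∀ β, coeff β (linSum (S.erase m) * restrict Q p) =
      if Q β then coeff β (linSum S * p) else 0 := by
    refine coeff_linSum_mul_restrict (Finset.erase_subset m S) fun α hα i hi => ?_
    rw [hQ.iff α hα i hi, Finset.mem_erase]
    simp [hi]
  have hsupp : (linSum (S.erase m) * restrict Q p).support =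
      {β ∈ (linSum S * p).support | Q β} := by
    ext β
    rw [mem_support_iff, hcoeff, Finset.mem_filter, mem_support_iff]
    by_cases h : Q β <;> simp [h]
  rw [← hsupp]
  refine ih (S.erase m) rfl _ (d - M) (fun α hα => ?_) ?_ fun β => ?_
  · rw [mem_support_iff, coeff_restrict] at hα
    split_ifs at hα with h
    · have h1 := hd α (mem_support_iff.2 hα)
      rw [← Finset.add_sum_erase S _ hm, hQ.level α h] at h1
      omega
    · exact absurd rfl hα
  · obtain ⟨ν, h1, h2⟩ := hQ.neg
    exact ⟨ν, by rwa [coeff_restrict, if_pos h1]⟩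
  · rw [hcoeff]
    split_ifs
    exacts [hpos β, le_rfl]

/-- The exponents obtained by raising a variable different from `m` in an exponent that lies below
all negative terms with respect to `m` belong to the support of the product. -/
lemma shifts_subset_support {S : Finset σ} {p : MvPolynomial σ ℝ} {m : σ} {π : σ →₀ ℕ}
    (hπ : π ∈ p.support) (hlow : ∀ ν, coeff ν p < 0 → π m < ν m) :
    shifts (S.erase m) π ⊆ (linSum S * p).support := by
  intro β hβ
  have hβm := apply_of_mem_shifts hβ
  obtain ⟨i, hi, rfl⟩ := mem_shifts.1 hβ
  have hp : 0 < coeff π p := by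
    refine lt_of_le_of_ne (not_lt.1 fun h => ?_) (Ne.symm (mem_support_iff.1 hπ))
    exact lt_irrefl _ (hlow π h)
  refine mem_support_iff.2 (coeff_linSum_mul_pos (Finset.mem_of_mem_erase hi) hp ?_).ne'
  intro j _ ν hν
  by_contra hneg
  have h1 := hlow ν (not_le.1 hneg)
  rw [← hν] at hβm
  simp at hβm
  omega

open Classical in
-- Induction gives `3(|S| - 1) - 4` terms in the slab. Outside it lie the `|S| - 1` shifts of `π`,
-- below level `M`, and a top term above it: at least three more, since `|S| ≥ 3`.
lemma IsSlab.card_support {S : Finset σ} {p : MvPolynomial σ ℝ} {m : σ} {M : ℕ}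
    {Q : (σ →₀ ℕ) → Prop} (hQ : IsSlab S p m M Q) (hm : m ∈ S) (hS : 3 ≤ S.card) {d : ℕ}
    (hd : ∀ α ∈ p.support, ∑ i ∈ S, α i = d) (hpos : ∀ β, 0 ≤ coeff β (linSum S * p))
    (ih : CardBound σ (S.erase m).card) (hM : ∀ ν, coeff ν p < 0 → M ≤ ν m)
    {π : σ →₀ ℕ} (hπ : π ∈ p.support) (hπM : π m < M) :
    3 * S.card ≤ (linSum S * p).support.card + 4 := by
  have h1 := hQ.card_le hm hd hpos ih
  have hSm := Finset.card_erase_of_mem hm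
  have hcard := Finset.card_filter_add_card_filter_not (s := (linSum S * p).support) (fun β => Q β)
  obtain ⟨ν, hνQ, hν⟩ := hQ.neg
  have hp : p ≠ 0 := by
    rintro rfl
    simp at hν
  obtain ⟨τ, hτ, hmax⟩ := exists_top_mem_support hp hm
  have hτM : M < τ m := hQ.level ν hνQ ▸ hmax ν (mem_support_iff.2 hν.ne)
  have hτs : τ ∉ shifts (S.erase m) π := fun h => by
    have := apply_of_mem_shifts h
    omega
  have hsub : insert τ (shifts (S.erase m) π) ⊆ {β ∈ (linSum S * p).support | ¬ Q β} := by
    intro β hβ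
    rw [Finset.mem_filter]
    rcases Finset.mem_insert.1 hβ with rfl | hβ
    · exact ⟨hτ, fun h => by have := hQ.level _ h; omega⟩
    · refine ⟨shifts_subset_support hπ (fun ν hν => hπM.trans_le (hM ν hν)) hβ, fun h => ?_⟩
      have h2 := hQ.level _ h
      have h3 := apply_of_mem_shifts hβ
      omega
  have h2 := Finset.card_le_card hsub
  rw [Finset.card_insert_of_notMem hτs, card_shifts] at h2
  omega

/-- The bound only asks for two terms: the top terms in the two variables differ, since a single
shift cannot exceed all of `p` in both. -/
lemma cardBound_two : CardBound σ 2 := by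
  intro S hS p d _ ⟨ν, hν⟩ _
  obtain ⟨i, j, hij, rfl⟩ := Finset.card_eq_two.1 hS
  have hp : p ≠ 0 := by
    rintro rfl
    simp at hν
  obtain ⟨β, hβ, hβi⟩ := exists_top_mem_support hp (l := i) (S := {i, j}) (by simp)
  obtain ⟨γ, hγ, hγj⟩ := exists_top_mem_support hp (l := j) (S := {i, j}) (by simp)
  have hne : β ≠ γ := by
    rintro rfl
    obtain ⟨α, hα, k, hk, rfl⟩ := exists_of_mem_support_linSum_mul hβ
    have h1 := hβi α hα
    have h2 := hγj α hα
    rcases Finset.mem_insert.1 hk with rfl | hk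
    · simp [hij] at h2
    · rw [Finset.mem_singleton.1 hk] at h1
      simp [hij.symm] at h1
  have := Finset.card_le_card (s := {β, γ}) (t := (linSum {i, j} * p).support)
    (by simp only [Finset.insert_subset_iff, Finset.singleton_subset_iff]; exact ⟨hβ, hγ⟩)
  rw [Finset.card_pair hne] at this
  omega

/-- If some level just below the lowest negative terms is empty, the bound follows from the bound
in one variable less. -/
lemma card_support_of_gap {S : Finset σ} (hS : 3 ≤ S.card) {p : MvPolynomial σ ℝ} {d : ℕ}
    (hd : ∀ α ∈ p.support, ∑ i ∈ S, α i = d) (hpos : ∀ β, 0 ≤ coeff β (linSum S * p)) {m : σ}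
    (hm : m ∈ S) (ih : CardBound σ (S.erase m).card) {M : ℕ}
    (hM : ∀ ν, coeff ν p < 0 → M ≤ ν m) (hneg : ∃ ν, ν m = M ∧ coeff ν p < 0)
    (hgap : ∀ α ∈ p.support, α m + 1 ≠ M) :
    3 * S.card ≤ (linSum S * p).support.card + 4 := by
  have hQ : IsSlab S p m M (fun α => α m = M) := by
    refine ⟨fun α h => h, fun α hα i hi => ?_, hneg⟩
    rcases eq_or_ne i m with rfl | h
    · simpa using hgap α hα
    · simp [h]
  by_cases hlow : ∃ π ∈ p.support, π m < M
  · obtain ⟨π, hπ, hπM⟩ := hlow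
    exact hQ.card_support hm hS hd hpos ih hM hπ hπM
  · push Not at hlow
    refine card_support_of_lowest_slab hm hS hpos hlow hneg ?_
    convert hQ.card_le hm hd hpos ih

/-! ### The case in which every level just below the negative terms is occupied. -/

section Occupied

variable {S : Finset σ} {p : MvPolynomial σ ℝ} {M : σ → ℕ}

/-- Three exponents of `p`, each lying below the negative terms in some direction, give many terms
if the first one has no common shift with the two others. -/
lemma card_support_of_three {u₁ u₂ u₃ : σ →₀ ℕ} {m₁ m₂ m₃ : σ}
    (hM : ∀ l ∈ S, ∀ ν, coeff ν p < 0 → M l ≤ ν l)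
    (h₁ : u₁ ∈ p.support) (h₂ : u₂ ∈ p.support) (h₃ : u₃ ∈ p.support)
    (hm₁ : m₁ ∈ S) (hm₂ : m₂ ∈ S) (hm₃ : m₃ ∈ S)
    (hl₁ : u₁ m₁ < M m₁) (hl₂ : u₂ m₂ < M m₂) (hl₃ : u₃ m₃ < M m₃) (hne : u₂ ≠ u₃)
    (hd₂ : Disjoint (shifts (S.erase m₁) u₁) (shifts (S.erase m₂) u₂))
    (hd₃ : Disjoint (shifts (S.erase m₁) u₁) (shifts (S.erase m₃) u₃)) :
    3 * S.card ≤ (linSum S * p).support.card + 4 := by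
  have hc : ∀ {m}, m ∈ S → ∀ u, S.card - 1 ≤ (shifts (S.erase m) u).card := fun hm u => by
    rw [card_shifts, Finset.card_erase_of_mem hm]
  have := card_union_three (hc hm₁ u₁) (hc hm₂ u₂) (hc hm₃ u₃)
    (shifts_subset_support h₁ fun ν hν => hl₁.trans_le (hM _ hm₁ ν hν))
    (shifts_subset_support h₂ fun ν hν => hl₂.trans_le (hM _ hm₂ ν hν))
    (shifts_subset_support h₃ fun ν hν => hl₃.trans_le (hM _ hm₃ ν hν))
    (Finset.card_eq_zero.2 (Finset.disjoint_iff_inter_eq_empty.1 hd₂)).le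
    (Finset.card_eq_zero.2 (Finset.disjoint_iff_inter_eq_empty.1 hd₃)).le
    (card_shifts_inter_le _ _ hne)
  omega

lemma disjoint_shifts_of_apply_ne {l : σ} {u v : σ →₀ ℕ} (h : u l ≠ v l) :
    Disjoint (shifts (S.erase l) u) (shifts (S.erase l) v) := by
  rw [Finset.disjoint_left]
  intro β h1 h2
  exact h ((apply_of_mem_shifts h1).symm.trans (apply_of_mem_shifts h2))

lemma disjoint_shifts_of_apply_lt {l : σ} {F : Finset σ} {u v : σ →₀ ℕ} (h : u l < v l) :
    Disjoint (shifts (S.erase l) u) (shifts F v) := by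
  rw [Finset.disjoint_left]
  intro β h1 h2
  have := apply_of_mem_shifts h1
  have := le_apply_of_mem_shifts l h2
  omega

/-- Three shift sets of size `|S| - 1` with at most one common point among them have a union of at
least `3|S| - 4` elements. Comparing `l`-exponents yields such a triple unless all of `U` lies on
one level below `M l`; then three overlaps are possible, and two terms at or above level `M l` make
up for them. -/
lemma card_support_of_three_low (hM : ∀ l ∈ S, ∀ ν, coeff ν p < 0 → M l ≤ ν l)
    (hatt : ∀ l ∈ S, ∃ ν, ν l = M l ∧ coeff ν p < 0)
    (hocc : ∀ l ∈ S, ∃ α ∈ p.support, α l + 1 = M l) (hS : 3 ≤ S.card)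
    {U : Finset (σ →₀ ℕ)} (hU : ∀ u, u ∈ U ↔ u ∈ p.support ∧ ∃ l ∈ S, u l < M l)
    (hUc : 3 ≤ U.card) :
    3 * S.card ≤ (linSum S * p).support.card + 4 := by
  obtain ⟨l, hl, m, hm, hlm⟩ := Finset.one_lt_card.1 (by omega : 1 < S.card)
  obtain ⟨α, hα, hαl⟩ := hocc l hl
  have hcard := Finset.card_filter_add_card_filter_not (s := U) (fun u => u l < M l)
  by_cases hV : {u ∈ U | u l < M l}.card ≤ 1
  · obtain ⟨u₂, hu₂, u₃, hu₃, hne⟩ := Finset.one_lt_card.1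
      (by omega : 1 < {u ∈ U | ¬ u l < M l}.card)
    simp only [Finset.mem_filter, hU] at hu₂ hu₃
    obtain ⟨⟨h₂, m₂, hm₂, hl₂⟩, h₂'⟩ := hu₂
    obtain ⟨⟨h₃, m₃, hm₃, hl₃⟩, h₃'⟩ := hu₃
    exact card_support_of_three hM hα h₂ h₃ hl hm₂ hm₃ (by omega) hl₂ hl₃ hne
      (disjoint_shifts_of_apply_lt (by omega)) (disjoint_shifts_of_apply_lt (by omega))
  by_cases hout : ∃ u ∈ U, ¬ u l < M l
  · obtain ⟨u₁, hu₁, hu₁l⟩ := hout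
    obtain ⟨h₁, m₁, hm₁, hl₁⟩ := (hU u₁).1 hu₁
    obtain ⟨u₂, hu₂, u₃, hu₃, hne⟩ := Finset.one_lt_card.1
      (by omega : 1 < {u ∈ U | u l < M l}.card)
    simp only [Finset.mem_filter, hU] at hu₂ hu₃
    exact card_support_of_three hM h₁ hu₂.1.1 hu₃.1.1 hm₁ hl hl hl₁ hu₂.2 hu₃.2 hne
      (disjoint_shifts_of_apply_lt (by omega)).symm (disjoint_shifts_of_apply_lt (by omega)).symm
  push Not at hout
  have hUs : ∀ u ∈ U, u ∈ p.support := fun u hu => ((hU u).1 hu).1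
  by_cases hlev : ∃ x ∈ U, ∃ y ∈ U, x l ≠ y l
  · obtain ⟨x, hx, y, hy, hxy⟩ := hlev
    obtain ⟨w, hw⟩ := Finset.card_pos.1 (by
      have := Finset.le_card_sdiff {x, y} U
      have := Finset.card_le_two (a := x) (b := y)
      omega : 0 < (U \ {x, y}).card)
    simp only [Finset.mem_sdiff, Finset.mem_insert, Finset.mem_singleton, not_or] at hw
    obtain ⟨hwU, hwx, hwy⟩ := hw
    by_cases hwl : w l = x l
    · exact card_support_of_three hM (hUs y hy) (hUs x hx) (hUs w hwU) hl hl hl (hout y hy)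
        (hout x hx) (hout w hwU) (Ne.symm hwx) (disjoint_shifts_of_apply_ne hxy.symm)
        (disjoint_shifts_of_apply_ne (by omega))
    · exact card_support_of_three hM (hUs x hx) (hUs y hy) (hUs w hwU) hl hl hl (hout x hx)
        (hout y hy) (hout w hwU) (Ne.symm hwy) (disjoint_shifts_of_apply_ne hxy)
        (disjoint_shifts_of_apply_ne (Ne.symm hwl))
  push Not at hlev
  -- All of `U` is on level `M l - 1`. The low term for a second variable `m` may also be shifted in
  -- direction `l`, which gives a term on level `M l` itself; the top term is strictly higher.
  obtain ⟨π, hπ, hπm⟩ := hocc m hm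
  have hπU : π ∈ U := (hU π).2 ⟨hπ, m, hm, by omega⟩
  have hαU : α ∈ U := (hU α).2 ⟨hα, l, hl, by omega⟩
  have hπl : π l + 1 = M l := by rw [hlev π hπU α hαU, hαl]
  obtain ⟨a, ha, b, hb, c, hc, hab, hac, hbc⟩ := Finset.two_lt_card.1 hUc
  obtain ⟨ν, hνl, hν⟩ := hatt l hl
  have hp : p ≠ 0 := by
    rintro rfl
    simp at hν
  obtain ⟨τ, hτ, hmax⟩ := exists_top_mem_support hp hl
  have hτν := hmax ν (mem_support_iff.2 hν.ne)
  have hsh : ∀ u ∈ U, shifts (S.erase l) u ⊆ {β ∈ (linSum S * p).support | β l < M l} := by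
    intro u hu β hβ
    refine Finset.mem_filter.2 ⟨shifts_subset_support (hUs u hu)
      (fun ν hν => (hout u hu).trans_le (hM l hl ν hν)) hβ, ?_⟩
    rw [apply_of_mem_shifts hβ]
    exact hout u hu
  have hc' : ∀ u, S.card - 1 ≤ (shifts (S.erase l) u).card := fun u => by
    rw [card_shifts, Finset.card_erase_of_mem hl]
  have h1 := card_union_three (hc' a) (hc' b) (hc' c) (hsh a ha) (hsh b hb) (hsh c hc)
    (card_shifts_inter_le _ _ hab) (card_shifts_inter_le _ _ hac) (card_shifts_inter_le _ _ hbc)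
  have hπB : π + Finsupp.single l 1 ∈ (linSum S * p).support :=
    shifts_subset_support hπ (m := m) (fun ν hν => by have := hM m hm ν hν; omega)
      (mem_shifts.2 ⟨l, Finset.mem_erase.2 ⟨hlm, hl⟩, rfl⟩)
  have hπv : (π + Finsupp.single l 1 : σ →₀ ℕ) l = M l := by simpa using hπl
  have hne : π + Finsupp.single l 1 ≠ τ := by
    rintro rfl
    omega
  have hsub : {π + Finsupp.single l 1, τ} ⊆ {β ∈ (linSum S * p).support | ¬ β l < M l} := by
    rw [Finset.insert_subset_iff, Finset.singleton_subset_iff, Finset.mem_filter,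
      Finset.mem_filter]
    exact ⟨⟨hπB, by omega⟩, hτ, by omega⟩
  have h2 := Finset.card_le_card hsub
  rw [Finset.card_pair hne] at h2
  have h3 := Finset.card_filter_add_card_filter_not (s := (linSum S * p).support)
    (fun β => β l < M l)
  omega

/-- The slab is cut down to exponents that are at least `M` in every coordinate; it still contains a
negative term. It fails to separate for `m` only if some low term steps into it. If this happens for
every `m`, a single low term steps exactly onto `M`, so `M` has degree `d + 1`, while a negative
term of degree `d` dominates `M`. -/
lemma card_support_of_few_low (hM : ∀ l ∈ S, ∀ ν, coeff ν p < 0 → M l ≤ ν l)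
    (hatt : ∀ l ∈ S, ∃ ν, ν l = M l ∧ coeff ν p < 0)
    (hocc : ∀ l ∈ S, ∃ α ∈ p.support, α l + 1 = M l) (hS : 3 ≤ S.card) {d : ℕ}
    (hd : ∀ α ∈ p.support, ∑ i ∈ S, α i = d) (hpos : ∀ β, 0 ≤ coeff β (linSum S * p))
    (ih : ∀ m ∈ S, CardBound σ (S.erase m).card)
    {U : Finset (σ →₀ ℕ)} (hU : ∀ u, u ∈ U ↔ u ∈ p.support ∧ ∃ l ∈ S, u l < M l)
    (hUc : U.card ≤ 2) :
    3 * S.card ≤ (linSum S * p).support.card + 4 := by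
  by_cases hgood : ∃ m ∈ S, ∀ π ∈ U, ∀ i ∈ S,
      (∀ j ∈ S, M j ≤ (π + Finsupp.single i 1 : σ →₀ ℕ) j) →
        (π + Finsupp.single i 1 : σ →₀ ℕ) m ≠ M m
  · obtain ⟨m, hm, hgood⟩ := hgood
    have hQ : IsSlab S p m (M m) (fun α => α m = M m ∧ ∀ j ∈ S, M j ≤ α j) := by
      refine ⟨fun α h => h.1, fun α hα i hi => ⟨fun ⟨h1, h2⟩ => ?_, fun ⟨⟨h1, h2⟩, h3⟩ => ?_⟩, ?_⟩
      · have h3 : ∀ j ∈ S, M j ≤ α j := by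
          by_contra! hlow
          exact hgood α ((hU α).2 ⟨hα, hlow⟩) i hi h2 h1
        have h4 := h3 m hm
        have h5 : i ≠ m := by
          rintro rfl
          simp at h1
          omega
        simp [h5] at h1
        exact ⟨⟨h1, h3⟩, h5⟩
      · exact ⟨by simpa [h3] using h1, fun j hj => (h2 j hj).trans (by simp)⟩
      · obtain ⟨ν, h1, h2⟩ := hatt m hm
        exact ⟨ν, ⟨h1, fun j hj => hM j hj ν h2⟩, h2⟩
    obtain ⟨π, hπ, hπm⟩ := hocc m hm
    exact hQ.card_support hm hS hd hpos (ih m hm) (hM m hm) hπ (by omega)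
  exfalso
  push Not at hgood
  -- A term that one step lifts above `M` is low in at most one coordinate. Hence two such terms
  -- cannot occupy the levels of three variables.
  have hthin : ∀ (π : σ →₀ ℕ) (i : σ),
      (∀ j ∈ S, M j ≤ (π + Finsupp.single i 1 : σ →₀ ℕ) j) → ∀ l ∈ S, π l < M l → l = i := by
    intro π i h l hl hlt
    by_contra hne
    have := h l hl
    simp [Ne.symm hne] at this
    omega
  obtain ⟨m₀, hm₀⟩ := Finset.card_pos.1 (by omega : 0 < S.card)
  obtain ⟨π₀, hπ₀, i₀, hi₀, hge₀, -⟩ := hgood m₀ hm₀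
  have huniq : ∀ m ∈ S, (π₀ + Finsupp.single i₀ 1 : σ →₀ ℕ) m = M m := by
    intro m hm
    obtain ⟨π, hπ, i, hi, hge, heq⟩ := hgood m hm
    have hππ : π = π₀ := by
      by_contra hne
      have hUeq : {π, π₀} = U := Finset.eq_of_subset_of_card_le
        (by simp [Finset.insert_subset_iff, hπ, hπ₀]) (by rw [Finset.card_pair hne]; exact hUc)
      have hSsub : S ⊆ {i, i₀} := by
        intro l hl
        obtain ⟨α, hα, hαl⟩ := hocc l hl
        have hαU : α ∈ U := (hU α).2 ⟨hα, l, hl, by omega⟩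
        rw [← hUeq, Finset.mem_insert, Finset.mem_singleton] at hαU
        rcases hαU with rfl | rfl
        · simp [hthin _ _ hge l hl (by omega)]
        · simp [hthin _ _ hge₀ l hl (by omega)]
      have := (Finset.card_le_card hSsub).trans Finset.card_le_two
      omega
    subst hππ
    obtain ⟨-, l, hl, hlt⟩ := (hU π).1 hπ
    rwa [← hthin _ _ hge₀ l hl hlt, hthin _ _ hge l hl hlt]
  have hsum := sum_add_single hi₀ π₀
  rw [Finset.sum_congr rfl huniq, hd π₀ ((hU π₀).1 hπ₀).1] at hsum
  obtain ⟨ν, -, hν⟩ := hatt i₀ hi₀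
  have h1 := Finset.sum_le_sum fun j hj => hM j hj ν hν
  rw [hd ν (mem_support_iff.2 hν.ne), hsum] at h1
  omega

end Occupied

theorem cardBound (k : ℕ) : CardBound σ (k + 2) := by
  induction k with
  | zero => exact cardBound_two
  | succ k ih =>
    intro S hS p d hd hneg hpos
    have hS3 : 3 ≤ S.card := by omega
    have ih' : ∀ m ∈ S, CardBound σ (S.erase m).card := fun m hm => by
      rw [Finset.card_erase_of_mem hm, hS]
      exact ih
    have hmin : ∀ l : σ, ∃ ν, coeff ν p < 0 ∧ ∀ ν', coeff ν' p < 0 → ν l ≤ ν' l := by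
      intro l
      obtain ⟨ν, h1, h2⟩ := Finset.exists_min_image {ν ∈ p.support | coeff ν p < 0}
        (fun ν => ν l) (by
          obtain ⟨ν, hν⟩ := hneg
          exact ⟨ν, Finset.mem_filter.2 ⟨mem_support_iff.2 hν.ne, hν⟩⟩)
      exact ⟨ν, (Finset.mem_filter.1 h1).2, fun ν' h =>
        h2 ν' (Finset.mem_filter.2 ⟨mem_support_iff.2 h.ne, h⟩)⟩
    choose μ hμ hμmin using hmin
    set M : σ → ℕ := fun l => μ l l
    have hM : ∀ l ∈ S, ∀ ν, coeff ν p < 0 → M l ≤ ν l := fun l _ => hμmin l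
    have hatt : ∀ l ∈ S, ∃ ν, ν l = M l ∧ coeff ν p < 0 := fun l _ => ⟨μ l, rfl, hμ l⟩
    by_cases hgap : ∃ m ∈ S, ∀ α ∈ p.support, α m + 1 ≠ M m
    · obtain ⟨m, hm, h⟩ := hgap
      exact card_support_of_gap hS3 hd hpos hm (ih' m hm) (hM m hm) (hatt m hm) h
    push Not at hgap
    classical
    have hU : ∀ u, u ∈ {u ∈ p.support | ∃ l ∈ S, u l < M l} ↔
        u ∈ p.support ∧ ∃ l ∈ S, u l < M l := fun u => Finset.mem_filter
    rcases le_or_gt 3 {u ∈ p.support | ∃ l ∈ S, u l < M l}.card with hUc | hUc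
    · exact card_support_of_three_low hM hatt hgap hS3 hU hUc
    · exact card_support_of_few_low hM hatt hgap hS3 hd hpos ih' hU (by omega)

end Counting

/-! ### Translation between diagonal Hermitian polynomials and real polynomials. -/

section Hermitian

open SOSConjecture

variable {n : ℕ}

lemma coeff_rename_inl_mul_rename_inr (f g : MvPolynomial (Fin n) ℂ) (α β : Fin n →₀ ℕ) :
    coeff (Finsupp.sumElim α β) (rename Sum.inl f * rename Sum.inr g : HermPoly n) =
      coeff α f * coeff β g := by
  induction f using MvPolynomial.induction_on' with
  | add f₁ f₂ h₁ h₂ => rw [map_add, add_mul, coeff_add, h₁, h₂, coeff_add, add_mul]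
  | monomial α' a =>
    induction g using MvPolynomial.induction_on' with
    | add g₁ g₂ h₁ h₂ => rw [map_add, mul_add, coeff_add, h₁, h₂, coeff_add, mul_add]
    | monomial β' b =>
      rw [rename_monomial, rename_monomial, monomial_mul, ← Finsupp.sumElim_eq_add,
        coeff_monomial, coeff_monomial, coeff_monomial]
      have : Finsupp.sumElim α' β' = Finsupp.sumElim α β ↔ α' = α ∧ β' = β := by
        refine ⟨fun h => ⟨?_, ?_⟩, fun h => by rw [h.1, h.2]⟩
        · ext i
          exact DFunLike.congr_fun h (Sum.inl i)
        · ext i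
          exact DFunLike.congr_fun h (Sum.inr i)
      simp only [this]
      by_cases h1 : α' = α <;> by_cases h2 : β' = β <;> simp [h1, h2]

/-- The Hermitian polynomial obtained from `P` by the substitution `xᵢ = zᵢ z̄ᵢ`. -/
def diagHerm (n : ℕ) : MvPolynomial (Fin n) ℂ →ₐ[ℂ] HermPoly n :=
  aeval fun i => X (Sum.inl i) * X (Sum.inr i)

lemma diagHerm_monomial (α : Fin n →₀ ℕ) (c : ℂ) :
    diagHerm n (monomial α c) = monomial (Finsupp.sumElim α α) c := by
  rw [diagHerm, aeval_monomial, algebraMap_eq, monomial_eq, Finsupp.prod_sumElim,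
    ← Finsupp.prod_mul]
  simp only [mul_pow, Function.comp_def]

lemma coeff_diagHerm (P : MvPolynomial (Fin n) ℂ) (α β : Fin n →₀ ℕ) :
    coeff (Finsupp.sumElim α β) (diagHerm n P) = if α = β then coeff α P else 0 := by
  induction P using MvPolynomial.induction_on' with
  | add f g hf hg =>
    rw [map_add, coeff_add, hf, hg, coeff_add]
    split_ifs <;> simp
  | monomial γ c =>
    have h := coeff_rename_inl_mul_rename_inr (monomial γ 1) (monomial γ c) α β
    rw [rename_monomial, rename_monomial, monomial_mul, ← Finsupp.sumElim_eq_add, one_mul,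
      ← diagHerm_monomial, coeff_monomial, coeff_monomial] at h
    rw [h, coeff_monomial]
    rcases eq_or_ne α β with rfl | hne
    · by_cases h1 : γ = α <;> simp [h1]
    · by_cases h1 : γ = α
      · subst h1
        simp [hne]
      · simp [h1, hne]

lemma value_diagHerm (P : MvPolynomial (Fin n) ℂ) (z : Fin n → ℂ) :
    value (diagHerm n P) z = eval (fun i => ((‖z i‖ ^ 2 : ℝ) : ℂ)) P := by
  have : (aeval (Sum.elim z fun i => (starRingEnd ℂ) (z i)) : HermPoly n →ₐ[ℂ] ℂ).comp
      (diagHerm n) = aeval fun i => ((‖z i‖ ^ 2 : ℝ) : ℂ) := by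
    ext i
    simp [diagHerm, Complex.mul_conj, Complex.normSq_eq_norm_sq]
  have h := DFunLike.congr_fun this P
  simpa [value, coe_aeval_eq_eval] using h

/-- A polynomial in `z` and `z̄` with vanishing values is zero. -/
lemma eq_zero_of_value_eq_zero {G : HermPoly n} (h : ∀ z, value G z = 0) : G = 0 := by
  -- Polarization: in the coordinates `z = x + iy`, `z̄ = x - iy`, vanishing values mean vanishing
  -- at all real `(x, y)`, which is enough for a polynomial.
  let φ : HermPoly n →ₐ[ℂ] HermPoly n := aeval (Sum.elim
    (fun i => X (Sum.inl i) + C Complex.I * X (Sum.inr i))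
    (fun i => X (Sum.inl i) - C Complex.I * X (Sum.inr i)))
  have heval : ∀ x : Fin n ⊕ Fin n → ℂ, eval x (φ G) = eval (Sum.elim
      (fun i => x (Sum.inl i) + Complex.I * x (Sum.inr i))
      (fun i => x (Sum.inl i) - Complex.I * x (Sum.inr i))) G := by
    intro x
    have : (aeval x : HermPoly n →ₐ[ℂ] ℂ).comp φ = aeval (Sum.elim
      (fun i => x (Sum.inl i) + Complex.I * x (Sum.inr i))
      (fun i => x (Sum.inl i) - Complex.I * x (Sum.inr i))) := by
      ext (i | i) <;> simp [φ]
    simpa [coe_aeval_eq_eval] using DFunLike.congr_fun this G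
  have hφ : φ G = 0 := by
    refine funext_set (fun _ => Set.range ((↑) : ℝ → ℂ))
      (fun _ => Set.infinite_range_of_injective Complex.ofReal_injective) fun x hx => ?_
    choose t ht using fun i => hx i (Set.mem_univ i)
    rw [heval, map_zero, ← h fun i => x (Sum.inl i) + Complex.I * x (Sum.inr i), value]
    congr 2
    ext (i | i)
    · rfl
    · simp [← ht, sub_eq_add_neg]
  refine MvPolynomial.funext fun y => ?_
  have h1 := heval (Sum.elim (fun i => (y (Sum.inl i) + y (Sum.inr i)) / 2)
    (fun i => (y (Sum.inl i) - y (Sum.inr i)) / (2 * Complex.I)))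
  rw [hφ, map_zero] at h1
  rw [map_zero, h1]
  congr 2
  ext (i | i) <;> simp <;> field_simp <;> ring

/-- The Hermitian polynomial obtained from a real polynomial by `xᵢ = zᵢ z̄ᵢ`. -/
def realHerm (n : ℕ) (p : MvPolynomial (Fin n) ℝ) : HermPoly n :=
  diagHerm n (map Complex.ofRealHom p)

lemma coeff_realHerm (p : MvPolynomial (Fin n) ℝ) (α β : Fin n →₀ ℕ) :
    coeff (Finsupp.sumElim α β) (realHerm n p) = if α = β then ((coeff α p : ℝ) : ℂ) else 0 := by
  rw [realHerm, coeff_diagHerm, coeff_map]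
  rfl

lemma realHerm_mul_normSq (p : MvPolynomial (Fin n) ℝ) :
    realHerm n p * normSq n = realHerm n (linSum Finset.univ * p) := by
  simp [realHerm, linSum, normSq, diagHerm, mul_comm]

lemma exists_eq_realHerm {A : HermPoly n} (hreal : IsRealValued A) (hdiag : IsDiagonal A) :
    ∃ p, A = realHerm n p := by
  have hdeg : ∀ α β : Fin n →₀ ℕ,
      (Finsupp.sumElim α β).degree = α.degree + β.degree := fun α β => by
    simp [Finsupp.degree_eq_sum]
  obtain ⟨P, rfl⟩ : ∃ P, A = diagHerm n P := by
    refine ⟨∑ m ∈ A.support, monomial (m.comapDomain Sum.inl Sum.inl_injective.injOn)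
      (coeff m A), ?_⟩
    conv_lhs => rw [A.as_sum]
    rw [map_sum]
    refine Finset.sum_congr rfl fun m hm => ?_
    rw [diagHerm_monomial]
    congr 1
    have hmm := Finsupp.comapDomain_sumElim_comapDomain m
    set α := m.comapDomain Sum.inl Sum.inl_injective.injOn
    set β := m.comapDomain Sum.inr Sum.inr_injective.injOn
    have h1 : m.degree ≤ A.totalDegree := le_totalDegree hm
    rw [← hmm, hdeg] at h1
    have : α = β := by
      by_contra hne
      have := hdiag (i := ⟨α, by omega⟩) (j := ⟨β, by omega⟩) (by simpa using hne)
      rw [matrixOf, coeffMatrix, Matrix.of_apply, hmm] at this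
      exact mem_support_iff.1 hm this
    rw [← hmm, ← this]
  -- At `zᵢ = √tᵢ` the value of `A` is `P(t)`, so `P` is real on an infinite grid of nonnegative
  -- points and has real coefficients.
  have hconj : map (starRingEnd ℂ) P = P := by
    refine funext_set (fun _ => (fun t : ℝ => (t : ℂ)) '' Set.Ici 0)
      (fun _ => (Set.Ici_infinite 0).image Complex.ofReal_injective.injOn) fun x hx => ?_
    choose t ht0 ht using fun i => hx i (Set.mem_univ i)
    have h1 := hreal fun i => ((√(t i) : ℝ) : ℂ)
    rw [value_diagHerm] at h1
    have h2 : (fun i => ((‖((√(t i) : ℝ) : ℂ)‖ ^ 2 : ℝ) : ℂ)) = x := by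
      ext i
      rw [← ht i, Complex.norm_real, Real.norm_eq_abs, sq_abs, Real.sq_sqrt (ht0 i)]
    rw [h2, ← Complex.conj_eq_iff_im] at h1
    have h3 : x = fun i => (starRingEnd ℂ) (x i) := by
      ext i
      rw [← ht i, Complex.conj_ofReal]
    rw [eval_map]
    conv_rhs => rw [← h1, eval, coe_eval₂Hom, hom_eval₂]
    conv_lhs => rw [h3]
    simp
  refine ⟨∑ α ∈ P.support, monomial α (coeff α P).re, ?_⟩
  rw [realHerm]
  congr 1
  conv_lhs => rw [P.as_sum]
  rw [map_sum]
  refine Finset.sum_congr rfl fun α _ => ?_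
  rw [map_monomial]
  congr 1
  have := congrArg (coeff α) hconj
  rw [coeff_map] at this
  exact (Complex.conj_eq_iff_re.1 this).symm

lemma rank_realHerm (p : MvPolynomial (Fin n) ℝ) : rank (realHerm n p) = p.support.card := by
  classical
  have hdeg : ∀ α ∈ p.support, α.degree ≤ (realHerm n p).totalDegree := by
    intro α hα
    have h1 : Finsupp.sumElim α α ∈ (realHerm n p).support := by
      rw [mem_support_iff, coeff_realHerm, if_pos rfl]
      simpa using hα
    have h2 : (Finsupp.sumElim α α).degree ≤ _ := le_totalDegree h1
    refine le_trans ?_ h2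
    simp [Finsupp.degree_eq_sum]
  have hmat : matrixOf (realHerm n p) = Matrix.diagonal fun α => ((coeff α.1 p : ℝ) : ℂ) := by
    ext α β
    rw [matrixOf, coeffMatrix, Matrix.of_apply, coeff_realHerm, Matrix.diagonal_apply]
    simp [Subtype.ext_iff]
  rw [rank, hmat, Matrix.rank_diagonal, Fintype.card_subtype, ← Finset.card_map
    (Function.Embedding.subtype _)]
  congr 1
  ext α
  simp only [Finset.mem_map, Finset.mem_filter, Finset.mem_univ, true_and,
    Function.Embedding.subtype_apply, Complex.ofReal_ne_zero, mem_support_iff]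
  constructor
  · rintro ⟨a, ha, rfl⟩
    exact ha
  · intro h
    exact ⟨⟨α, hdeg α (mem_support_iff.2 h)⟩, h, rfl⟩

/-- In an SOS the coefficient of `z^α z̄^α` is the sum of the squared moduli of the
`z^α`-coefficients of the `hᵢ`. Conversely, the monomials `√(p_α) z^α` serve as the `hᵢ`. -/
lemma isSOS_realHerm_iff (p : MvPolynomial (Fin n) ℝ) :
    IsSOS (realHerm n p) ↔ ∀ α, 0 ≤ coeff α p := by
  constructor
  · rintro ⟨R, h, hh⟩ α
    have hG : realHerm n p = ∑ i, rename Sum.inl (h i) *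
        rename Sum.inr (map (starRingEnd ℂ) (h i)) := by
      rw [← sub_eq_zero]
      refine eq_zero_of_value_eq_zero fun z => ?_
      rw [value, map_sub, sub_eq_zero]
      refine (hh z).trans ?_
      rw [map_sum, Complex.ofReal_sum]
      refine Finset.sum_congr rfl fun i _ => ?_
      rw [map_mul, eval_rename, eval_rename, Sum.elim_comp_inl, Sum.elim_comp_inr, eval_map]
      have : eval₂ (starRingEnd ℂ) (fun i => (starRingEnd ℂ) (z i)) (h i) =
          (starRingEnd ℂ) (eval z (h i)) := by
        rw [eval, coe_eval₂Hom, hom_eval₂]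
        simp
      rw [this, Complex.mul_conj, Complex.normSq_eq_norm_sq]
    have h1 := congrArg (coeff (Finsupp.sumElim α α)) hG
    rw [coeff_realHerm, if_pos rfl, coeff_sum] at h1
    simp only [coeff_rename_inl_mul_rename_inr, coeff_map, Complex.mul_conj] at h1
    rw [← Complex.ofReal_sum] at h1
    rw [Complex.ofReal_injective h1]
    exact Finset.sum_nonneg fun i _ => Complex.normSq_nonneg _
  · intro hp
    let e := p.support.equivFin
    refine ⟨p.support.card, fun k => monomial (e.symm k).1
      ((√(coeff (e.symm k).1 p) : ℝ) : ℂ), fun z => ?_⟩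
    rw [realHerm, value_diagHerm, eval_map, eval₂_eq, Complex.ofReal_sum,
      e.symm.sum_comp (fun α : p.support => ((‖eval z (monomial α.1
        ((√(coeff α.1 p) : ℝ) : ℂ))‖ ^ 2 : ℝ) : ℂ)), ← Finset.sum_coe_sort]
    refine Finset.sum_congr rfl fun α _ => ?_
    rw [eval_monomial, norm_mul, mul_pow, Complex.norm_real, Real.norm_eq_abs, sq_abs,
      Real.sq_sqrt (hp _), Finsupp.prod, norm_prod, ← Finset.prod_pow]
    simp only [norm_pow, Complex.ofReal_mul, Complex.ofReal_prod, Complex.ofReal_pow]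
    congr 1
    refine Finset.prod_congr rfl fun i _ => ?_
    rw [← pow_mul, ← pow_mul, mul_comm]

/-! ### Polynomials without negative coefficients. -/

section Nonneg

variable {σ : Type*} [DecidableEq σ] {S : Finset σ} {p : MvPolynomial σ ℝ}

lemma shifts_subset_support_of_nonneg (hp : ∀ α, 0 ≤ coeff α p) {π : σ →₀ ℕ}
    (hπ : π ∈ p.support) : shifts S π ⊆ (linSum S * p).support := by
  intro β hβ
  obtain ⟨i, hi, rfl⟩ := mem_shifts.1 hβ
  exact mem_support_iff.2 (coeff_linSum_mul_pos hi
    (lt_of_le_of_ne (hp π) (Ne.symm (mem_support_iff.1 hπ))) fun _ _ ν _ => hp ν).ne'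

lemma card_support_linSum_mul_le (S : Finset σ) (p : MvPolynomial σ ℝ) :
    (linSum S * p).support.card ≤ p.support.card * S.card := by
  refine (Finset.card_le_card fun β hβ => ?_).trans
    (Finset.card_biUnion_le_card_mul p.support (shifts S) S.card fun u _ => (card_shifts S u).le)
  obtain ⟨α, hα, i, hi, rfl⟩ := exists_of_mem_support_linSum_mul hβ
  exact Finset.mem_biUnion.2 ⟨α, hα, mem_shifts.2 ⟨i, hi, rfl⟩⟩

lemma card_le_of_nonneg (hp : ∀ α, 0 ≤ coeff α p) (h : 1 ≤ p.support.card) :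
    S.card ≤ (linSum S * p).support.card := by
  obtain ⟨u, hu⟩ := Finset.card_pos.1 h
  rw [← card_shifts S u]
  exact Finset.card_le_card (shifts_subset_support_of_nonneg hp hu)

lemma two_mul_card_le_of_nonneg (hp : ∀ α, 0 ≤ coeff α p) (h : 2 ≤ p.support.card) :
    2 * S.card ≤ (linSum S * p).support.card + 1 := by
  obtain ⟨u, hu, v, hv, huv⟩ := Finset.one_lt_card.1 h
  have h1 := Finset.card_union_add_card_inter (shifts S u) (shifts S v)
  have h2 := card_shifts_inter_le S S huv
  have h3 := Finset.card_le_card (Finset.union_subset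
    (shifts_subset_support_of_nonneg (S := S) hp hu) (shifts_subset_support_of_nonneg hp hv))
  rw [card_shifts, card_shifts] at h1
  omega

lemma three_mul_card_le_of_nonneg (hp : ∀ α, 0 ≤ coeff α p) (h : 3 ≤ p.support.card) :
    3 * S.card ≤ (linSum S * p).support.card + 3 := by
  obtain ⟨u, hu, v, hv, w, hw, huv, huw, hvw⟩ := Finset.two_lt_card.1 h
  have := card_union_three (card_shifts S u).ge (card_shifts S v).ge (card_shifts S w).ge
    (shifts_subset_support_of_nonneg hp hu) (shifts_subset_support_of_nonneg hp hv)
    (shifts_subset_support_of_nonneg hp hw) (card_shifts_inter_le S S huv)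
    (card_shifts_inter_le S S huw) (card_shifts_inter_le S S hvw)
  omega

end Nonneg

/-- If `p` has a negative coefficient and its product with the sum of the `n` variables has none,
then this product has at least `3n - 4` terms. -/
lemma three_mul_le_card_support {n : ℕ} (hn : 2 ≤ n) {p : MvPolynomial (Fin n) ℝ}
    (hneg : ∃ ν, coeff ν p < 0) (hpos : ∀ β, 0 ≤ coeff β (linSum Finset.univ * p)) :
    3 * n ≤ (linSum Finset.univ * p).support.card + 4 := by
  obtain ⟨ν, hν⟩ := hneg
  obtain ⟨k, rfl⟩ := Nat.exists_eq_add_of_le' hn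
  set S : Finset (Fin (k + 2)) := Finset.univ
  -- The homogeneous component containing a negative term; its product with the linear form is a
  -- component of the whole product.
  set r := restrict (fun α => ∑ i ∈ S, α i = ∑ i ∈ S, ν i) p with hr
  have hcoeff : ∀ β, coeff β (linSum S * r) =
      if ∑ i ∈ S, β i = ∑ i ∈ S, ν i + 1 then coeff β (linSum S * p) else 0 := by
    intro β
    rw [hr, coeff_linSum_mul_restrict (Finset.Subset.refl S)
      (Q' := fun β => ∑ i ∈ S, β i = ∑ i ∈ S, ν i + 1)]
    · split_ifs <;> rfl
    · intro α _ i hi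
      rw [sum_add_single hi]
      simp [hi]
  have h := cardBound k S (by simp [S]) r (∑ i ∈ S, ν i) (fun α hα => ?_) ?_ fun β => ?_
  · rw [Finset.card_univ, Fintype.card_fin] at h
    refine h.trans (Nat.add_le_add_right (Finset.card_le_card fun β hβ => ?_) 4)
    rw [mem_support_iff, hcoeff] at hβ
    split_ifs at hβ
    · exact mem_support_iff.2 hβ
    · exact absurd rfl hβ
  · rw [mem_support_iff, hr, coeff_restrict] at hα
    split_ifs at hα with h
    · exact h
    · exact absurd rfl hα
  · exact ⟨ν, by rwa [hr, coeff_restrict, if_pos rfl]⟩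
  · rw [hcoeff]
    split_ifs
    exacts [hpos β, le_rfl]

/-! ### The rank alternative for `n ≤ 6`. -/

lemma isGreatest_triangular {n κ : ℕ} (h1 : κ * (κ + 1) < 2 * n)
    (h2 : 2 * n ≤ (κ + 1) * (κ + 2)) :
    IsGreatest {k : ℕ | (k : ℚ) * (k + 1) / 2 < n} κ := by
  have key : ∀ k : ℕ, (k : ℚ) * (k + 1) / 2 < n ↔ k * (k + 1) < 2 * n := by
    intro k
    rw [div_lt_iff₀ two_pos, ← Nat.cast_lt (α := ℚ)]
    push_cast
    rw [mul_comm (2 : ℚ)]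
  refine ⟨(key κ).2 h1, fun k hk => ?_⟩
  by_contra! hlt
  have h3 := (key k).1 hk
  have h4 : (κ + 1) * (κ + 2) ≤ k * (k + 1) := Nat.mul_le_mul hlt (by omega)
  omega

/-- For `4 ≤ n ≤ 6`, `κ₀ = 2` and the first alternative is exactly `R ≥ 3n - 4`. For `n ≤ 3`, `κ₀ =
1` and it reads `R ≥ 2n - 2`, which is weaker because `n ≥ 2`. -/
lemma rankAlternative_of_three_mul_le {n R : ℕ} (hn : 2 ≤ n) (hn6 : n ≤ 6)
    (h : 3 * n ≤ R + 4) : RankAlternative n R := by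
  have hR : (3 : ℚ) * n ≤ R + 4 := by exact_mod_cast h
  rcases le_or_gt n 3 with h3 | h3
  · refine ⟨1, isGreatest_triangular (by omega) (by omega), Or.inl ?_⟩
    have : (2 : ℚ) ≤ n := by exact_mod_cast hn
    push_cast
    linarith
  · refine ⟨2, isGreatest_triangular (by omega) (by omega), Or.inl ?_⟩
    push_cast
    linarith

lemma rankAlternative_of_nonneg {n : ℕ} (hn : 2 ≤ n) (hn6 : n ≤ 6)
    {p : MvPolynomial (Fin n) ℝ} (hp : ∀ α, 0 ≤ coeff α p) :
    RankAlternative n (linSum Finset.univ * p).support.card := by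
  have hcard : (Finset.univ : Finset (Fin n)).card = n := by simp
  have hle := card_support_linSum_mul_le Finset.univ p
  have h1 := card_le_of_nonneg (S := Finset.univ) hp
  have h2 := two_mul_card_le_of_nonneg (S := Finset.univ) hp
  have h3 := three_mul_card_le_of_nonneg (S := Finset.univ) hp
  rw [hcard] at hle h1 h2 h3
  set R := (linSum Finset.univ * p).support.card
  obtain ⟨κ₀, hκ₀, hκ1, hκ2, hκn⟩ : ∃ κ₀, IsGreatest {k : ℕ | (k : ℚ) * (k + 1) / 2 < n} κ₀ ∧
      1 ≤ κ₀ ∧ κ₀ ≤ 2 ∧ (κ₀ = 1 → n ≤ 3) := by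
    rcases le_or_gt n 3 with h | h
    · exact ⟨1, isGreatest_triangular (by omega) (by omega), by omega, by omega, fun _ => h⟩
    · exact ⟨2, isGreatest_triangular (by omega) (by omega), by omega, by omega, by omega⟩
  by_cases hr3 : 3 ≤ p.support.card
  · exact rankAlternative_of_three_mul_le hn hn6 (by have := h3 hr3; omega)
  refine ⟨κ₀, hκ₀, ?_⟩
  by_cases hr : p.support.card ≤ κ₀
  -- The witness `κ` is the number of terms of `p`.
  · refine Or.inr ⟨p.support.card, hr, ?_, by exact_mod_cast hle⟩
    interval_cases hc : p.support.card
    · simp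
    · simpa using h1 le_rfl
    · have : (2 : ℚ) * n ≤ R + 1 := by exact_mod_cast h2 le_rfl
      push_cast
      linarith
  · obtain rfl : κ₀ = 1 := by omega
    have : (2 : ℚ) * n ≤ R + 1 := by exact_mod_cast h2 (by omega)
    left
    push_cast
    linarith

end Hermitian

end DiagonalSOS

end

theorem corollary1p2 (n : ℕ) (hn : 2 ≤ n) (A : SOSConjecture.HermPoly n)
    (hreal : SOSConjecture.IsRealValued A) (hdiag : SOSConjecture.IsDiagonal A) :
    (¬ SOSConjecture.IsSOS A → SOSConjecture.IsSOS (A * SOSConjecture.normSq n) →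
      3 * (n : ℤ) - 4 ≤ (SOSConjecture.rank (A * SOSConjecture.normSq n) : ℤ)) ∧
    (n ≤ 6 → SOSConjecture.EbenfeltConjectureFor A) := by
  obtain ⟨p, rfl⟩ := DiagonalSOS.exists_eq_realHerm hreal hdiag
  rw [SOSConjecture.EbenfeltConjectureFor, DiagonalSOS.realHerm_mul_normSq,
    DiagonalSOS.rank_realHerm, DiagonalSOS.isSOS_realHerm_iff, DiagonalSOS.isSOS_realHerm_iff]
  have key : (¬ ∀ α, 0 ≤ MvPolynomial.coeff α p) →
      (∀ β, 0 ≤ MvPolynomial.coeff β (DiagonalSOS.linSum Finset.univ * p)) →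
      3 * n ≤ (DiagonalSOS.linSum Finset.univ * p).support.card + 4 := fun hneg hpos =>
    DiagonalSOS.three_mul_le_card_support hn (by simpa using hneg) hpos
  refine ⟨fun hneg hpos => ?_, fun hn6 hpos => ?_⟩
  · have := key hneg hpos
    omega
  · by_cases hp : ∀ α, 0 ≤ MvPolynomial.coeff α p
    · exact DiagonalSOS.rankAlternative_of_nonneg hn hn6 hp
    · exact DiagonalSOS.rankAlternative_of_three_mul_le hn hn6 (key hp hpos)
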